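/- **Theorem.** Consider a star with centre $v_0$ and $n \ge 0$ leaves, embedded so that the leaves $v_1,\dots,v_n$ occur in this cyclic order clockwise around $v_0$, with positive real vertex weights $w_0,\dots,w_n$. A weighted disk contact (WDC) representation of the star is a family of disks $D_0,\dots,D_n$ in the plane with pairwise disjoint interiors such that two disks touch if and only if the corresponding vertices are adjacent (that is, $D_0$ touches every $D_i$ with $i \ge 1$, and no two of $D_1,\dots,D_n$ touch) and such that, for some $c>0$, the radius of $D_i$ is $c\,w_i$ for every $i$. It respects the embedding if the directions from the centre of $D_0$ to the centres of $D_1,\dots,D_n$ occur in this cyclic order clockwise around the centre of $D_0$. There are a Real RAM program and a constant $C$ such that, for every $n\ge 0$ and all positive real weights $w_0,\dots,w_n$, the program on input $(w_0,\dots,w_n)$ halts after at most $C\,(n+1)$ steps, answers "yes" if and only if the star has a WDC representation respecting the embedding, and, whenever it answers "yes", has output the centre coordinates and radii of all the disks of such a representation. That is, the existence of a WDC representation respecting the embedding can be decided in linear time, and such a representation, if one exists, can be constructed in linear time. Here a Real RAM is a random access machine whose memory cells hold exact real numbers and are addressed through natural-number index registers. In one step it performs an addition or a (truncated) subtraction of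 indices, one of the real operations $+,-,\times,\div,\sqrt{\cdot},\sin,\cos,\arccos$, a comparison of two reals or two indices with a conditional jump, a memory access, or the output of one real number. Its program constants are natural and rational numbers, and there is no rounding. -/

import Mathlib

/-! ### A Real RAM with a step count -/

namespace RealRAM

/-- Binary operations on reals, each performed in one step. -/
inductive BinOp where
  | add
  | sub
  | mul
  | div

/-- Unary operations on reals, each performed in one step. -/
inductive UnOp where
  | sqrt
  | sin
  | cos
  | arccos

/-- The value of a binary operation; division by zero is undefined. -/
noncomputable def BinOp.eval : BinOp → ℝ → ℝ → Option ℝ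
  | .add, x, y => some (x + y)
  | .sub, x, y => some (x - y)
  | .mul, x, y => some (x * y)
  | .div, x, y => if y = 0 then none else some (x / y)

/-- The value of a unary operation; square roots of negative numbers and arc cosines of numbers
outside `[-1, 1]` are undefined. -/
noncomputable def UnOp.eval : UnOp → ℝ → Option ℝ
  | .sqrt, x => if 0 ≤ x then some (Real.sqrt x) else none
  | .sin, x => some (Real.sin x)
  | .cos, x => some (Real.cos x)
  | .arccos, x => if -1 ≤ x ∧ x ≤ 1 then some (Real.arccos x) else none

/-- Instructions. The machine has index registers (natural numbers), real registers, an unbounded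
array of real memory cells that is addressed through index registers, and an output tape. Real
numbers can be neither rounded nor converted to indices, and the only real constants that a program
can mention are rational. -/
inductive Instr where
  /-- index register `d` := the constant `k` -/
  | iconst (d k : ℕ)
  /-- index register `d` := index register `a` + index register `b` -/
  | iadd (d a b : ℕ)
  /-- index register `d` := index register `a` - index register `b` (truncated at `0`) -/
  | isub (d a b : ℕ)
  /-- go to instruction `l` if index register `a` < index register `b` -/
  | ijumpLT (a b l : ℕ)
  /-- real register `d` := the constant `q` -/
  | rconst (d : ℕ) (q : ℚ)
  /-- real register `d` := `op` (real register `a`) -/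
  | un (op : UnOp) (d a : ℕ)
  /-- real register `d` := (real register `a`) `op` (real register `b`) -/
  | bin (op : BinOp) (d a b : ℕ)
  /-- go to instruction `l` if real register `a` < real register `b` -/
  | rjumpLT (a b l : ℕ)
  /-- real register `d` := the memory cell whose address is in index register `i` -/
  | load (d i : ℕ)
  /-- the memory cell whose address is in index register `i` := real register `a` -/
  | store (i a : ℕ)
  /-- append the content of real register `a` to the output tape -/
  | write (a : ℕ)
  /-- go to instruction `l` -/
  | jump (l : ℕ)
  /-- stop and answer `b` -/
  | halt (b : Bool)

/-- A program is a finite list of instructions. -/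
abbrev Program := List Instr

/-- A configuration of the machine. -/
structure Config where
  pc : ℕ
  idx : ℕ → ℕ
  reg : ℕ → ℝ
  mem : ℕ → ℝ
  out : List ℝ

/-- The effect of one instruction. It is `none` on `halt` and when an operation is undefined. -/
noncomputable def Instr.exec (s : Config) : Instr → Option Config
  | .iconst d k => some { s with pc := s.pc + 1, idx := Function.update s.idx d k }
  | .iadd d a b =>
      some { s with pc := s.pc + 1, idx := Function.update s.idx d (s.idx a + s.idx b) }
  | .isub d a b =>
      some { s with pc := s.pc + 1, idx := Function.update s.idx d (s.idx a - s.idx b) }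
  | .ijumpLT a b l => some { s with pc := if s.idx a < s.idx b then l else s.pc + 1 }
  | .rconst d q => some { s with pc := s.pc + 1, reg := Function.update s.reg d (q : ℝ) }
  | .un op d a => (op.eval (s.reg a)).map fun x =>
      { s with pc := s.pc + 1, reg := Function.update s.reg d x }
  | .bin op d a b => (op.eval (s.reg a) (s.reg b)).map fun x =>
      { s with pc := s.pc + 1, reg := Function.update s.reg d x }
  | .rjumpLT a b l => some { s with pc := if s.reg a < s.reg b then l else s.pc + 1 }
  | .load d i =>
      some { s with pc := s.pc + 1, reg := Function.update s.reg d (s.mem (s.idx i)) }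
  | .store i a =>
      some { s with pc := s.pc + 1, mem := Function.update s.mem (s.idx i) (s.reg a) }
  | .write a => some { s with pc := s.pc + 1, out := s.out ++ [s.reg a] }
  | .jump l => some { s with pc := l }
  | .halt _ => none

/-- One step: execute the instruction at the program counter, if there is one. -/
noncomputable def step (P : Program) (s : Config) : Option Config :=
  (P[s.pc]?).bind (Instr.exec s)

/-- `Reaches P s s' t`: from `s`, exactly `t` steps of `P` lead to `s'`. -/
inductive Reaches (P : Program) : Config → Config → ℕ → Prop where
  | refl (s : Config) : Reaches P s s 0
  | head {s s' s'' : Config} {t : ℕ} (h : step P s = some s') (h' : Reaches P s' s'' t) :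
      Reaches P s s'' (t + 1)

/-- The initial configuration on input `x 0, …, x (m - 1)`: the input is in the memory cells
`0, …, m - 1`, its length `m` is in index register `0`, and everything else is zero or empty. -/
noncomputable def init {m : ℕ} (x : Fin m → ℝ) : Config where
  pc := 0
  idx := fun i => if i = 0 then m else 0
  reg := fun _ => 0
  mem := fun a => if h : a < m then x ⟨a, h⟩ else 0
  out := []

/-- On input `x` the program `P` halts within `T` steps (the final `halt` included) with answer `b`
and with `out` on the output tape. -/
def HaltsWithin (P : Program) {m : ℕ} (x : Fin m → ℝ) (T : ℕ) (b : Bool) (out : List ℝ) : Prop :=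
  ∃ (t : ℕ) (s : Config), Reaches P (init x) s t ∧ t + 1 ≤ T ∧
    P[s.pc]? = some (Instr.halt b) ∧ s.out = out

end RealRAM

/-! ### Disk contact representations -/

/-- The disks with centres `p v` and radii `r v` are a disk contact representation of `G`: they are
interior-disjoint, and two of them touch if and only if the vertices are adjacent. -/
structure IsDiskContactRep {V : Type*} (G : SimpleGraph V) (p : V → EuclideanSpace ℝ (Fin 2))
    (r : V → ℝ) : Prop where
  radius_pos : ∀ v, 0 < r v
  interior_disjoint : ∀ u v, u ≠ v → Disjoint (Metric.ball (p u) (r u)) (Metric.ball (p v) (r v))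
  touch_iff_adj : ∀ u v, u ≠ v →
    ((Metric.closedBall (p u) (r u) ∩ Metric.closedBall (p v) (r v)).Nonempty ↔ G.Adj u v)

/-- A disk contact representation whose radii are proportional to the vertex weights. -/
def IsWeightedDiskContactRep {V : Type*} (G : SimpleGraph V) (w : V → ℝ)
    (p : V → EuclideanSpace ℝ (Fin 2)) (r : V → ℝ) : Prop :=
  IsDiskContactRep G p r ∧ ∃ c : ℝ, 0 < c ∧ ∀ v, r v = c * w v

/-- Seen from `o`, the points `q 0, …, q (n - 1)` lie in pairwise distinct directions, and these
directions appear in this cyclic order clockwise around `o`. -/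
def InClockwiseOrder {n : ℕ} (o : EuclideanSpace ℝ (Fin 2))
    (q : Fin n → EuclideanSpace ℝ (Fin 2)) : Prop :=
  ∃ θ : Fin n → ℝ, StrictMono θ ∧ (∀ i j, θ j < θ i + 2 * Real.pi) ∧
    ∀ i, ∃ d : ℝ, 0 < d ∧ q i = o + d • !₂[Real.cos (θ i), -Real.sin (θ i)]

/-- The embedded vertex-weighted star with `n` leaves has centre `0`, leaves `1, …, n` in this
clockwise order around the centre, and vertex weights `w`. This says that the disks with centres
`p v` and radii `r v` are a weighted disk contact representation of it that respects its
embedding. -/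
def IsEmbeddedStarRep {n : ℕ} (w : Fin (n + 1) → ℝ) (p : Fin (n + 1) → EuclideanSpace ℝ (Fin 2))
    (r : Fin (n + 1) → ℝ) : Prop :=
  IsWeightedDiskContactRep (SimpleGraph.starGraph (0 : Fin (n + 1))) w p r ∧
    InClockwiseOrder (p 0) (fun i : Fin n => p i.succ)

/-- A family of disks written out as the list `x₀, y₀, r₀, x₁, y₁, r₁, …`. -/
def encodeDisks {m : ℕ} (p : Fin m → EuclideanSpace ℝ (Fin 2)) (r : Fin m → ℝ) : List ℝ :=
  (List.ofFn fun v => [p v 0, p v 1, r v]).flatten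

/-!
The program places the leaves greedily around a heaviest leaf.

Scale all radii so that they equal the weights, and let `R` be the radius of the centre disk. Two
disks of radii `a` and `b` that touch the centre disk are disjoint if and only if the directions of
their centres differ by more than `sepAngle R a b`, the angle for which all three disks touch
(`add_lt_dist_iff`). So a representation is a choice of directions that are pairwise separated in
this cyclic sense; neighbouring leaves do not suffice, because a small disk may sit between two
large ones.

Cut the cyclic order at a heaviest leaf `M`, and let position `0` and position `n` both stand for
`M`. Placing every leaf at the least angle allowed by all earlier positions gives `angle`, and any
strict solution exceeds it at every later position (`angle_lt_of_separated`). Hence a representation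
forces the second angle `T` of `M` to be less than `2π`
(`angle_lt_two_pi_of_isEmbeddedStarRep`). Conversely, if `T < 2π`, then multiplying all angles by
`2π / T > 1` makes the separations strict. Separation across the cut is automatic: going from one
leaf to another across the cut passes `M`, and `sepAngle` grows with the weights, so being far
enough from `M` is enough (`isEmbeddedStarRep_stretched`).

For the linear time bound, a leaf need not be compared with all earlier ones. If `k` lies between
`i` and `j` and is at least as heavy as one of the two, then the constraints of `k` with `i` and
`j` imply the one between `i` and `j`. The earlier leaves that still matter therefore form a stack
with weights that do not decrease from top to bottom; a new leaf pops the lighter ones and is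
compared only with these and with the next one (`scan`, `angle_add_sepAngle_le`). Since every leaf
is pushed once, the total number of comparisons is linear: in `SweepInv.step` the stack length acts
as a potential. The leaf `M` at the bottom is never popped, so the stack is never empty.

The program `prog` is verified by invariants at the heads of its loops, each carried by a predicate
on configurations, and by the relation `Leads`, which bounds the number of steps.
-/

namespace StarRep

/-! ### The angle that two leaves need -/

/-- The angle under which the centres of two disks of radii `a` and `b` are seen from the centre of
a disk of radius `R` when the three disks touch each other. -/
noncomputable def sepAngle (R a b : ℝ) : ℝ :=
  Real.arccos (1 - 2 * (a * b / ((R + a) * (R + b))))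

variable {R a a' b b' x : ℝ}

lemma sepRatio_pos (hR : 0 < R) (ha : 0 < a) (hb : 0 < b) :
    0 < a * b / ((R + a) * (R + b)) := by positivity

lemma sepRatio_lt_one (hR : 0 < R) (ha : 0 < a) (hb : 0 < b) :
    a * b / ((R + a) * (R + b)) < 1 := by
  rw [div_lt_one (by positivity)]
  nlinarith [mul_pos hR ha, mul_pos hR hb, mul_pos hR hR]

lemma sepAngle_pos (hR : 0 < R) (ha : 0 < a) (hb : 0 < b) : 0 < sepAngle R a b := by
  rw [sepAngle, Real.arccos_pos]
  linarith [sepRatio_pos hR ha hb]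

lemma sepAngle_le_pi : sepAngle R a b ≤ Real.pi := Real.arccos_le_pi _

lemma sepAngle_comm : sepAngle R a b = sepAngle R b a := by
  simp only [sepAngle, mul_comm a b, mul_comm (R + a)]

lemma cos_sepAngle (hR : 0 < R) (ha : 0 < a) (hb : 0 < b) :
    Real.cos (sepAngle R a b) = 1 - 2 * (a * b / ((R + a) * (R + b))) :=
  Real.cos_arccos (by linarith [sepRatio_lt_one hR ha hb]) (by linarith [sepRatio_pos hR ha hb])

lemma sepAngle_mono_left (hR : 0 < R) (ha : 0 < a) (hb : 0 < b) (h : a ≤ a') :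
    sepAngle R a b ≤ sepAngle R a' b := by
  apply Real.arccos_le_arccos
  have : a / (R + a) ≤ a' / (R + a') := by
    rw [div_le_div_iff₀ (by positivity) (by linarith)]
    nlinarith
  have := mul_le_mul_of_nonneg_right this (show 0 ≤ b / (R + b) by positivity)
  rw [div_mul_div_comm, div_mul_div_comm] at this
  linarith

lemma sepAngle_mono_right (hR : 0 < R) (ha : 0 < a) (hb : 0 < b) (h : b ≤ b') :
    sepAngle R a b ≤ sepAngle R a b' := by
  rw [sepAngle_comm, sepAngle_comm (a := a)]
  exact sepAngle_mono_left hR hb ha h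

/-! ### The monotone stack -/

/-- Look through a stack of pairs (weight, angle), from the top, for the leaves that a new leaf of
weight `x` has to keep away from. Entries lighter than `x` are popped and the search stops at the
first entry that is not. The result is the remaining stack and the maximum of `b` and the lower
bounds on the new angle that have been met. -/
noncomputable def scan (R x : ℝ) : List (ℝ × ℝ) → ℝ → List (ℝ × ℝ) × ℝ
  | [], b => ([], b)
  | p :: L, b =>
      if p.1 < x then scan R x L (max b (p.2 + sepAngle R p.1 x))
      else (p :: L, max b (p.2 + sepAngle R p.1 x))

/-- The order on stacks: going down, weights do not decrease, and the angles of any two entries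
are far enough apart. -/
def Stacked (R : ℝ) (L : List (ℝ × ℝ)) : Prop :=
  L.Pairwise fun p q => p.1 ≤ q.1 ∧ q.2 + sepAngle R q.1 p.1 ≤ p.2

lemma le_scan (L : List (ℝ × ℝ)) (b : ℝ) : b ≤ (scan R x L b).2 := by
  induction L generalizing b with
  | nil => simp [scan]
  | cons p L ih =>
    simp only [scan]
    split_ifs
    · exact (le_max_left _ _).trans (ih _)
    · exact le_max_left _ _

/-- The entries that `scan` does not look at are dominated by the entry at which it stops. -/
lemma scan_dominates (hR : 0 < R) (hx : 0 < x) {L : List (ℝ × ℝ)} (hL : Stacked R L)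
    (hpos : ∀ p ∈ L, 0 < p.1) (b : ℝ) :
    ∀ p ∈ L, p.2 + sepAngle R p.1 x ≤ (scan R x L b).2 := by
  induction L generalizing b with
  | nil => simp
  | cons q L ih =>
    obtain ⟨hq, hL⟩ := List.pairwise_cons.1 hL
    simp only [scan]
    intro p hp
    split_ifs with h
    · rcases List.mem_cons.1 hp with rfl | hp
      · exact (le_max_right _ _).trans (le_scan _ _)
      · exact ih hL (fun p hp => hpos p (List.mem_cons_of_mem _ hp)) _ p hp
    · rcases List.mem_cons.1 hp with rfl | hp'
      · exact le_max_right _ _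
      · refine le_trans ?_ (le_max_right _ _)
        have h1 := sepAngle_mono_right hR (hpos p hp) hx (not_lt.1 h)
        have h2 := sepAngle_pos hR (hpos q (by simp)) hx
        linarith [(hq p hp').2]

lemma scan_attained (L : List (ℝ × ℝ)) (b : ℝ) :
    (scan R x L b).2 = b ∨ ∃ p ∈ L, (scan R x L b).2 = p.2 + sepAngle R p.1 x := by
  induction L generalizing b with
  | nil => simp [scan]
  | cons p L ih =>
    simp only [scan]
    split_ifs
    · rcases ih (max b (p.2 + sepAngle R p.1 x)) with h | ⟨q, hq, h⟩
      · rcases max_choice b (p.2 + sepAngle R p.1 x) with h' | h'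
        · exact .inl (h.trans h')
        · exact .inr ⟨p, by simp, h.trans h'⟩
      · exact .inr ⟨q, by simp [hq], h⟩
    · rcases max_choice b (p.2 + sepAngle R p.1 x) with h | h
      · exact .inl h
      · exact .inr ⟨p, by simp, h⟩

lemma scan_suffix (L : List (ℝ × ℝ)) (b : ℝ) : (scan R x L b).1 <:+ L := by
  induction L generalizing b with
  | nil => simp [scan]
  | cons p L ih =>
    simp only [scan]
    split_ifs
    · exact (ih _).trans (List.suffix_cons _ _)
    · exact List.suffix_refl _

lemma mem_scan_or_lt (L : List (ℝ × ℝ)) (b : ℝ) {p : ℝ × ℝ} (hp : p ∈ L) :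
    p ∈ (scan R x L b).1 ∨ p.1 < x := by
  induction L generalizing b with
  | nil => simp at hp
  | cons q L ih =>
    simp only [scan]
    split_ifs with h
    · rcases List.mem_cons.1 hp with rfl | hp
      · exact .inr h
      · exact ih _ hp
    · exact .inl hp

lemma le_of_mem_scan {L : List (ℝ × ℝ)} (hL : Stacked R L) (b : ℝ) :
    ∀ p ∈ (scan R x L b).1, x ≤ p.1 := by
  induction L generalizing b with
  | nil => simp [scan]
  | cons q L ih =>
    obtain ⟨hq, hL⟩ := List.pairwise_cons.1 hL
    simp only [scan]
    split_ifs with h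
    · exact ih hL _
    · intro p hp
      rcases List.mem_cons.1 hp with rfl | hp
      · exact not_lt.1 h
      · exact (not_lt.1 h).trans (hq p hp).1

variable {W : ℕ → ℝ}

/-- The stack after the leaves at positions `0, …, k` have been placed as early as possible, where
`W` is the sequence of weights and the leaf at position `0` has angle `0`. -/
noncomputable def sweep (R : ℝ) (W : ℕ → ℝ) : ℕ → List (ℝ × ℝ)
  | 0 => [(W 0, 0)]
  | k + 1 =>
      (W (k + 1), (scan R (W (k + 1)) (sweep R W k) 0).2) :: (scan R (W (k + 1)) (sweep R W k) 0).1

/-- The earliest possible angle of the leaf at position `k`. -/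
noncomputable def angle (R : ℝ) (W : ℕ → ℝ) : ℕ → ℝ
  | 0 => 0
  | k + 1 => (scan R (W (k + 1)) (sweep R W k) 0).2

lemma angle_zero (R : ℝ) (W : ℕ → ℝ) : angle R W 0 = 0 := rfl

lemma angle_succ (R : ℝ) (W : ℕ → ℝ) (k : ℕ) :
    angle R W (k + 1) = (scan R (W (k + 1)) (sweep R W k) 0).2 := rfl

lemma sweep_succ (R : ℝ) (W : ℕ → ℝ) (k : ℕ) : sweep R W (k + 1) =
    (W (k + 1), angle R W (k + 1)) :: (scan R (W (k + 1)) (sweep R W k) 0).1 := rfl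

lemma exists_of_mem_sweep {k : ℕ} {p : ℝ × ℝ} (hp : p ∈ sweep R W k) :
    ∃ i ≤ k, p = (W i, angle R W i) := by
  induction k with
  | zero => exact ⟨0, le_rfl, by simpa [sweep, angle] using hp⟩
  | succ k ih =>
    rcases List.mem_cons.1 hp with rfl | hp
    · exact ⟨k + 1, le_rfl, rfl⟩
    · obtain ⟨i, hi, h⟩ := ih ((scan_suffix _ _).subset hp)
      exact ⟨i, by omega, h⟩

lemma pos_of_mem_sweep (hW : ∀ k, 0 < W k) {k : ℕ} {p : ℝ × ℝ} (hp : p ∈ sweep R W k) :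
    0 < p.1 := by
  obtain ⟨i, -, rfl⟩ := exists_of_mem_sweep hp
  exact hW i

lemma stacked_sweep (hR : 0 < R) (hW : ∀ k, 0 < W k) (k : ℕ) : Stacked R (sweep R W k) := by
  induction k with
  | zero => simp [sweep, Stacked]
  | succ k ih =>
    refine List.pairwise_cons.2 ⟨fun p hp => ⟨le_of_mem_scan ih _ p hp, ?_⟩,
      List.Pairwise.sublist (scan_suffix _ _).sublist ih⟩
    exact scan_dominates hR (hW _) ih (fun p hp => pos_of_mem_sweep hW hp) _ p
      ((scan_suffix _ _).subset hp)

/-- A popped leaf is dominated by a leaf that is heavier and has a larger angle. -/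
lemma exists_dominating_mem_sweep (hR : 0 < R) (hW : ∀ k, 0 < W k) {i k : ℕ} (hik : i ≤ k) :
    ∃ p ∈ sweep R W k, W i ≤ p.1 ∧ angle R W i ≤ p.2 := by
  induction k with
  | zero =>
    obtain rfl : i = 0 := by omega
    exact ⟨(W 0, 0), by simp [sweep, angle]⟩
  | succ k ih =>
    rcases hik.eq_or_lt with rfl | hik
    · exact ⟨_, List.mem_cons_self, le_rfl, le_rfl⟩
    · obtain ⟨p, hp, h1, h2⟩ := ih (by omega)
      have hpos := pos_of_mem_sweep hW hp
      rcases mem_scan_or_lt (R := R) (x := W (k + 1)) _ 0 hp with h | h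
      · exact ⟨p, List.mem_cons_of_mem _ h, h1, h2⟩
      · refine ⟨_, List.mem_cons_self, h1.trans h.le, h2.trans ?_⟩
        have h3 := scan_dominates hR (hW (k + 1)) (stacked_sweep hR hW k)
          (fun p hp => pos_of_mem_sweep hW hp) 0 p hp
        linarith [sepAngle_pos hR hpos (hW (k + 1))]

/-- Although `scan` looks at few of the earlier leaves, it takes all of them into account. -/
lemma angle_add_sepAngle_le (hR : 0 < R) (hW : ∀ k, 0 < W k) {i j : ℕ} (hij : i < j) :
    angle R W i + sepAngle R (W i) (W j) ≤ angle R W j := by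
  obtain ⟨k, rfl⟩ : ∃ k, j = k + 1 := ⟨j - 1, by omega⟩
  obtain ⟨p, hp, h1, h2⟩ := exists_dominating_mem_sweep hR hW (show i ≤ k by omega)
  have h3 := scan_dominates hR (hW (k + 1)) (stacked_sweep hR hW k)
    (fun p hp => pos_of_mem_sweep hW hp) 0 p hp
  have h4 := sepAngle_mono_left hR (hW i) (hW (k + 1)) h1
  rw [angle_succ]
  linarith

lemma angle_strictMono (hR : 0 < R) (hW : ∀ k, 0 < W k) : StrictMono (angle R W) :=
  fun i j hij => by
    linarith [angle_add_sepAngle_le hR hW hij, sepAngle_pos hR (hW i) (hW j)]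

lemma exists_angle_eq (hR : 0 < R) (hW : ∀ k, 0 < W k) {j : ℕ} (hj : 0 < j) :
    ∃ i < j, angle R W j = angle R W i + sepAngle R (W i) (W j) := by
  have hpos := angle_strictMono hR hW hj
  obtain ⟨k, rfl⟩ : ∃ k, j = k + 1 := ⟨j - 1, by omega⟩
  rw [angle_zero, angle_succ] at hpos
  rw [angle_succ]
  rcases scan_attained (R := R) (x := W (k + 1)) (sweep R W k) 0 with h | ⟨p, hp, h⟩
  · exact absurd h hpos.ne'
  · obtain ⟨i, hi, rfl⟩ := exists_of_mem_sweep hp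
    exact ⟨i, by omega, h⟩

/-- No placement precedes the one given by `angle`. -/
lemma angle_lt_of_separated (hR : 0 < R) (hW : ∀ k, 0 < W k) {n : ℕ} {φ : ℕ → ℝ}
    (hφ : ∀ i j, i < j → j ≤ n → sepAngle R (W i) (W j) < φ j - φ i) {j : ℕ} (hj : 0 < j)
    (hjn : j ≤ n) : angle R W j < φ j - φ 0 := by
  induction j using Nat.strong_induction_on with
  | _ j ih =>
    obtain ⟨i, hij, h⟩ := exists_angle_eq hR hW hj
    have h1 := hφ i j hij hjn
    rcases Nat.eq_zero_or_pos i with rfl | hi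
    · rw [angle_zero] at h
      linarith
    · linarith [ih i hij hi (by omega)]

end StarRep

namespace StarRep

/-! ### Disks around a disk -/

/-- The unit vector at clockwise angle `t`. -/
noncomputable def dir (t : ℝ) : EuclideanSpace ℝ (Fin 2) := !₂[Real.cos t, -Real.sin t]

lemma norm_dir (t : ℝ) : ‖dir t‖ = 1 := by
  simp [dir, EuclideanSpace.norm_eq, Fin.sum_univ_two]

lemma dist_add_smul_dir (o : EuclideanSpace ℝ (Fin 2)) {d : ℝ} (hd : 0 ≤ d) (t : ℝ) :
    dist o (o + d • dir t) = d := by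
  simp [norm_smul, norm_dir, abs_of_nonneg hd]

lemma dir_sub_two_pi (t : ℝ) : dir (t - 2 * Real.pi) = dir t := by
  simp [dir]

/-- The law of cosines for two points in polar coordinates. -/
lemma dist_smul_dir_sq (o : EuclideanSpace ℝ (Fin 2)) (d e s t : ℝ) :
    dist (o + d • dir s) (o + e • dir t) ^ 2 = d ^ 2 + e ^ 2 - 2 * d * e * Real.cos (t - s) := by
  rw [dist_add_left, EuclideanSpace.dist_eq, Real.sq_sqrt (by positivity), Real.cos_sub]
  simp only [dir, Fin.sum_univ_two, Real.dist_eq, sq_abs, PiLp.smul_apply, smul_eq_mul,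
    Matrix.cons_val_zero, Matrix.cons_val_one, Matrix.cons_val_fin_one]
  linear_combination d ^ 2 * Real.cos_sq_add_sin_sq s + e ^ 2 * Real.cos_sq_add_sin_sq t

lemma cos_lt_cos_iff_of_lt_two_pi {x α : ℝ} (h0 : 0 < x) (h1 : x < 2 * Real.pi) (hα : 0 ≤ α)
    (hα' : α ≤ Real.pi) : Real.cos x < Real.cos α ↔ α < x ∧ x < 2 * Real.pi - α := by
  have h : Real.cos (2 * Real.pi - x) = Real.cos x := Real.cos_two_pi_sub x
  constructor
  · intro hx
    constructor
    · by_contra! hc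
      exact hx.not_ge (Real.cos_le_cos_of_nonneg_of_le_pi h0.le hα' hc)
    · by_contra! hc
      rw [← h] at hx
      exact hx.not_ge (Real.cos_le_cos_of_nonneg_of_le_pi (by linarith) hα' (by linarith))
  · rintro ⟨h2, h3⟩
    rcases le_total x Real.pi with hx | hx
    · exact Real.cos_lt_cos_of_nonneg_of_le_pi hα hx h2
    · rw [← h]
      exact Real.cos_lt_cos_of_nonneg_of_le_pi hα (by linarith) (by linarith)

variable {R a b : ℝ}

/-- Two disks that touch a disk of radius `R` from outside are disjoint if and only if the
directions of their centres differ by more than `sepAngle`. -/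
lemma add_lt_dist_iff (hR : 0 < R) (ha : 0 < a) (hb : 0 < b) (o : EuclideanSpace ℝ (Fin 2))
    {s t : ℝ} (hst : s < t) (hts : t < s + 2 * Real.pi) :
    a + b < dist (o + (R + a) • dir s) (o + (R + b) • dir t) ↔
      sepAngle R a b < t - s ∧ t - s < 2 * Real.pi - sepAngle R a b := by
  rw [← cos_lt_cos_iff_of_lt_two_pi (by linarith) (by linarith) (sepAngle_pos hR ha hb).le
    sepAngle_le_pi, cos_sepAngle hR ha hb, ← sq_lt_sq₀ (by positivity) dist_nonneg,
    dist_smul_dir_sq]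
  have h : (R + a) ^ 2 + (R + b) ^ 2 - 2 * (R + a) * (R + b) * Real.cos (t - s) - (a + b) ^ 2 =
      2 * ((R + a) * (R + b)) *
        (1 - 2 * (a * b / ((R + a) * (R + b))) - Real.cos (t - s)) := by
    field_simp
    ring
  rw [← sub_pos, h, mul_pos_iff_of_pos_left (by positivity), sub_pos]

lemma sepAngle_scale {c : ℝ} (hc : 0 < c) (hR : 0 < R) (ha : 0 < a) (hb : 0 < b) :
    sepAngle (c * R) (c * a) (c * b) = sepAngle R a b := by
  unfold sepAngle
  congr 3
  field_simp

/-! ### Cutting the cyclic order at one leaf -/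

/-- The leaf at position `k` if the leaves `1, …, n` are gone through in cyclic order, starting
with the leaf `M` at position `0`. -/
def leaf (n M : ℕ) : ℕ → ℕ
  | 0 => M
  | k + 1 => if leaf n M k + 1 < n + 1 then leaf n M k + 1 else 1

/-- The position in `1, …, n` at which the leaf `v` is met; it is `n` for `v = M`. -/
def position (n M v : ℕ) : ℕ := if v ≤ M then v + n - M else v - M

variable {n M : ℕ}

lemma leaf_bounds (h1 : 1 ≤ M) (h2 : M ≤ n) (k : ℕ) : 1 ≤ leaf n M k ∧ leaf n M k ≤ n := by
  induction k with
  | zero => exact ⟨h1, h2⟩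
  | succ k ih =>
    simp only [leaf]
    split_ifs <;> omega

lemma leaf_eq (h2 : M ≤ n) {k : ℕ} (hk : k ≤ n) :
    leaf n M k = if M + k ≤ n then M + k else M + k - n := by
  induction k with
  | zero => simp [leaf, h2]
  | succ k ih =>
    rw [leaf, ih (by omega)]
    split_ifs <;> omega

lemma leaf_self (h1 : 1 ≤ M) (h2 : M ≤ n) : leaf n M n = M := by
  rw [leaf_eq h2 le_rfl]
  split_ifs <;> omega

lemma leaf_ne (h2 : M ≤ n) {k : ℕ} (hk : 0 < k) (hkn : k < n) : leaf n M k ≠ M := by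
  rw [leaf_eq h2 hkn.le]
  split_ifs <;> omega

lemma position_bounds {v : ℕ} (h2 : M ≤ n) (hv : 1 ≤ v) (hv' : v ≤ n) :
    1 ≤ position n M v ∧ position n M v ≤ n := by
  unfold position
  split_ifs <;> omega

lemma leaf_position {v : ℕ} (h2 : M ≤ n) (hv : 1 ≤ v) (hv' : v ≤ n) :
    leaf n M (position n M v) = v := by
  rw [leaf_eq h2 (position_bounds h2 hv hv').2]
  unfold position
  split_ifs <;> omega

lemma position_leaf {k : ℕ} (h2 : M ≤ n) (hk : 1 ≤ k) (hk' : k ≤ n) :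
    position n M (leaf n M k) = k := by
  rw [leaf_eq h2 hk']
  unfold position
  split_ifs <;> omega

/-- A family of reals, extended by `0` to all natural numbers. -/
noncomputable def extend {m : ℕ} (w : Fin m → ℝ) (a : ℕ) : ℝ := if h : a < m then w ⟨a, h⟩ else 0

lemma extend_val {m : ℕ} (w : Fin m → ℝ) (v : Fin m) : extend w v = w v := by simp [extend]

lemma extend_pos {w : Fin (n + 1) → ℝ} (hw : ∀ v, 0 < w v) {a : ℕ} (ha : a ≤ n) :
    0 < extend w a := by
  rw [extend, dif_pos (by omega)]
  exact hw _

lemma extend_leaf_pos {w : Fin (n + 1) → ℝ} (hw : ∀ v, 0 < w v) (h1 : 1 ≤ M) (h2 : M ≤ n)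
    (k : ℕ) : 0 < extend w (leaf n M k) :=
  extend_pos hw (leaf_bounds h1 h2 k).2

/-! ### Necessity -/

/-- In a representation that respects the embedding, the directions of the leaves are pairwise
separated in the cyclic sense. -/
lemma exists_separated_of_isEmbeddedStarRep {w : Fin (n + 1) → ℝ} (hw : ∀ v, 0 < w v)
    {p : Fin (n + 1) → EuclideanSpace ℝ (Fin 2)} {r : Fin (n + 1) → ℝ}
    (h : IsEmbeddedStarRep w p r) :
    ∃ θ : Fin n → ℝ, ∀ i j, i < j → sepAngle (w 0) (w i.succ) (w j.succ) < θ j - θ i ∧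
      θ j - θ i < 2 * Real.pi - sepAngle (w 0) (w i.succ) (w j.succ) := by
  obtain ⟨⟨⟨hr, hdisj, htouch⟩, c, hc, hcw⟩, θ, hmono, hθ, hdir⟩ := h
  refine ⟨θ, fun i j hij => ?_⟩
  have hp (i : Fin n) : p i.succ = p 0 + (r 0 + r i.succ) • dir (θ i) := by
    obtain ⟨d, hd, hq⟩ := hdir i
    change p i.succ = p 0 + d • dir (θ i) at hq
    have hne : (0 : Fin (n + 1)) ≠ i.succ := (Fin.succ_ne_zero i).symm
    have h1 := (disjoint_ball_ball_iff (hr _) (hr _)).1 (hdisj 0 i.succ hne)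
    have h2 : dist (p 0) (p i.succ) ≤ r 0 + r i.succ := by
      by_contra! hlt
      have h3 := (htouch 0 i.succ hne).2 (SimpleGraph.starGraph_center_adj hne)
      exact Set.not_disjoint_iff_nonempty_inter.2 h3 (Metric.closedBall_disjoint_closedBall hlt)
    have h3 : dist (p 0) (p i.succ) = d := by rw [hq, dist_add_smul_dir _ hd.le]
    rw [hq, show d = r 0 + r i.succ by linarith]
  have hne : i.succ ≠ j.succ := fun h => hij.ne (Fin.succ_injective _ h)
  have hfar : r i.succ + r j.succ < dist (p i.succ) (p j.succ) := by
    rw [← disjoint_closedBall_closedBall_iff (hr _).le (hr _).le, ← not_not (a := Disjoint _ _),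
      Set.not_disjoint_iff_nonempty_inter, htouch _ _ hne]
    simp [SimpleGraph.starGraph_adj]
  rw [hp i, hp j, add_lt_dist_iff (hr _) (hr _) (hr _) _ (hmono hij) (hθ i j), hcw, hcw, hcw,
    sepAngle_scale hc (hw _) (hw _) (hw _)] at hfar
  exact hfar

lemma angle_lt_two_pi_of_isEmbeddedStarRep {w : Fin (n + 1) → ℝ} (hw : ∀ v, 0 < w v)
    (h1 : 1 ≤ M) (h2 : M ≤ n) {p : Fin (n + 1) → EuclideanSpace ℝ (Fin 2)} {r : Fin (n + 1) → ℝ}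
    (h : IsEmbeddedStarRep w p r) :
    angle (w 0) (fun k => extend w (leaf n M k)) n < 2 * Real.pi := by
  obtain ⟨θ, hθ⟩ := exists_separated_of_isEmbeddedStarRep hw h
  have hθ' (i j : ℕ) (hi : 1 ≤ i) (hij : i < j) (hj : j ≤ n) :
      sepAngle (w 0) (extend w i) (extend w j) < extend θ (j - 1) - extend θ (i - 1) ∧
        extend θ (j - 1) - extend θ (i - 1) <
          2 * Real.pi - sepAngle (w 0) (extend w i) (extend w j) := by
    have := hθ ⟨i - 1, by omega⟩ ⟨j - 1, by omega⟩ (by simp; omega)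
    have hs (i : ℕ) (hi : 1 ≤ i) (hj : i ≤ n) :
        w (Fin.succ ⟨i - 1, by omega⟩) = extend w i := by
      rw [extend, dif_pos (by omega)]
      congr 1
      ext
      simp
      omega
    rw [hs i hi (by omega), hs j (by omega) hj] at this
    rwa [show extend θ (j - 1) = _ from dif_pos (by omega),
      show extend θ (i - 1) = _ from dif_pos (by omega)]
  have hn : 0 < n := by omega
  -- Unroll the directions along the sequence of positions: they increase by `2π` in one turn.
  have key := angle_lt_of_separated (hw 0) (extend_leaf_pos hw h1 h2) (n := n)
    (φ := fun k => if M + k ≤ n then extend θ (M + k - 1)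
      else extend θ (M + k - n - 1) + 2 * Real.pi) ?_ hn le_rfl
  · simp only [show ¬ M + n ≤ n by omega, if_false, add_zero, h2, if_true] at key
    rw [show M + n - n - 1 = M - 1 by omega] at key
    linarith
  · intro i j hij hj
    rw [leaf_eq h2 (by omega), leaf_eq h2 hj]
    split_ifs with hi hj' hj'
    · exact (hθ' _ _ (by omega) (by omega) (by omega)).1
    · rcases eq_or_ne (M + j - n) (M + i) with he | he
      · rw [he]
        linarith [sepAngle_le_pi (R := w 0) (a := extend w (M + i)) (b := extend w (M + i)),
          Real.pi_pos]
      · have := (hθ' (M + j - n) (M + i) (by omega) (by omega) (by omega)).2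
        rw [sepAngle_comm] at this
        linarith
    · omega
    · have := (hθ' (M + i - n) (M + j - n) (by omega) (by omega) (by omega)).1
      linarith

/-! ### Sufficiency -/

/-- Centres of disks around a disk with centre `0` and radius `R`: the disk `v ≥ 1` has radius
`u v` and lies at the clockwise angle `Θ v`. -/
noncomputable def centre (R : ℝ) (u Θ : ℕ → ℝ) (v : ℕ) : EuclideanSpace ℝ (Fin 2) :=
  if v = 0 then 0 else (R + u v) • dir (Θ v)

lemma isEmbeddedStarRep_centre {w : Fin (n + 1) → ℝ} (hw : ∀ v, 0 < w v) (Θ : ℕ → ℝ)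
    (hΘ : ∀ i j, 1 ≤ i → i < j → j ≤ n →
      sepAngle (w 0) (extend w i) (extend w j) < Θ j - Θ i ∧
      Θ j - Θ i < 2 * Real.pi - sepAngle (w 0) (extend w i) (extend w j)) :
    IsEmbeddedStarRep w (fun v => centre (w 0) (extend w) Θ v) w := by
  have hlt (i j : ℕ) (hi : 1 ≤ i) (hij : i < j) (hj : j ≤ n) : Θ i < Θ j := by
    linarith [hΘ i j hi hij hj,
      sepAngle_pos (hw 0) (extend_pos hw (show i ≤ n by omega)) (extend_pos hw hj)]
  have hlt' (i j : ℕ) (hi : 1 ≤ i) (hij : i < j) (hj : j ≤ n) : Θ j < Θ i + 2 * Real.pi := by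
    linarith [hΘ i j hi hij hj,
      sepAngle_pos (hw 0) (extend_pos hw (show i ≤ n by omega)) (extend_pos hw hj)]
  -- Both conditions on pairs of disks follow from the distances of their centres.
  have hdist (u v : Fin (n + 1)) (huv : u < v) :
      (u = 0 → dist (centre (w 0) (extend w) Θ u) (centre (w 0) (extend w) Θ v) = w u + w v) ∧
      (u ≠ 0 → w u + w v < dist (centre (w 0) (extend w) Θ u) (centre (w 0) (extend w) Θ v)) := by
    have hv : (v : ℕ) ≠ 0 := by
      have : (u : ℕ) < v := huv
      omega
    constructor
    · rintro rfl
      have := dist_add_smul_dir 0 (add_pos (hw 0) (hw v)).le (Θ v)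
      rw [zero_add] at this
      simpa [centre, hv, extend_val] using this
    · intro hu
      have hu' : (u : ℕ) ≠ 0 := fun h => hu (Fin.ext h)
      have hvn : (v : ℕ) ≤ n := by omega
      have h1 : 1 ≤ (u : ℕ) := by omega
      have := (add_lt_dist_iff (hw 0) (extend_pos hw (show (u : ℕ) ≤ n by omega))
        (extend_pos hw hvn) 0 (hlt u v h1 huv hvn)
        (hlt' u v h1 huv hvn)).2 (hΘ u v h1 huv hvn)
      simpa [centre, hv, hu', extend_val] using this
  have hge (u v : Fin (n + 1)) (huv : u < v) :
      w u + w v ≤ dist (centre (w 0) (extend w) Θ u) (centre (w 0) (extend w) Θ v) := by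
    by_cases hu : u = 0
    · exact ((hdist u v huv).1 hu).ge
    · exact ((hdist u v huv).2 hu).le
  have hiff (u v : Fin (n + 1)) (huv : u < v) :
      w u + w v < dist (centre (w 0) (extend w) Θ u) (centre (w 0) (extend w) Θ v) ↔ u ≠ 0 :=
    ⟨fun h h0 => h.ne' ((hdist u v huv).1 h0), (hdist u v huv).2⟩
  refine ⟨⟨⟨hw, fun u v huv => ?_, fun u v huv => ?_⟩, 1, one_pos, by simp⟩,
    fun i => Θ (i + 1), fun i j hij => ?_, fun i j => ?_, fun i => ?_⟩
  · rcases lt_or_gt_of_ne huv with h | h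
    · exact Metric.ball_disjoint_ball (hge u v h)
    · exact (Metric.ball_disjoint_ball (hge v u h)).symm
  · rw [← Set.not_disjoint_iff_nonempty_inter, SimpleGraph.starGraph_adj]
    rcases lt_or_gt_of_ne huv with h | h
    · have hv : v ≠ 0 := (Fin.zero_le u).trans_lt h |>.ne'
      rw [disjoint_closedBall_closedBall_iff (hw _).le (hw _).le, hiff u v h]
      simp [huv, hv]
    · have hv : u ≠ 0 := (Fin.zero_le v).trans_lt h |>.ne'
      rw [disjoint_comm, disjoint_closedBall_closedBall_iff (hw _).le (hw _).le, hiff v u h]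
      simp [huv, hv]
  · exact hlt _ _ (by omega) (by simpa using hij) (by omega)
  · rcases lt_trichotomy i j with h | rfl | h
    · exact hlt' _ _ (by omega) (by simpa using h) (by omega)
    · linarith [Real.pi_pos]
    · linarith [hlt (j + 1) (i + 1) (by omega) (by simpa using h) (by omega), Real.pi_pos]
  · refine ⟨w 0 + w i.succ, add_pos (hw _) (hw _), ?_⟩
    have : extend w ((i : ℕ) + 1) = w i.succ := extend_val w i.succ
    simp [centre, this, dir]

lemma centre_congr {R : ℝ} {u Θ Θ' : ℕ → ℝ} {v : ℕ} (h : v ≠ 0 → dir (Θ v) = dir (Θ' v)) :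
    centre R u Θ v = centre R u Θ' v := by
  unfold centre
  split_ifs with h0
  · rfl
  · rw [h h0]

/-- If the leaves fit into less than a full turn when the order is cut at a heaviest leaf, then
stretching all angles to the full turn makes all the separations strict, including those across
the cut. -/
lemma isEmbeddedStarRep_stretched {w : Fin (n + 1) → ℝ} (hw : ∀ v, 0 < w v) (h1 : 1 ≤ M)
    (h2 : M ≤ n) (hM : ∀ a, 1 ≤ a → a ≤ n → extend w a ≤ extend w M)
    (hT : angle (w 0) (fun k => extend w (leaf n M k)) n < 2 * Real.pi) :
    IsEmbeddedStarRep w (fun v => centre (w 0) (extend w)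
      (fun v => angle (w 0) (fun k => extend w (leaf n M k)) (position n M v) *
        (2 * Real.pi / angle (w 0) (fun k => extend w (leaf n M k)) n)) v) w := by
  set W : ℕ → ℝ := fun k => extend w (leaf n M k) with hW
  have hWpos : ∀ k, 0 < W k := extend_leaf_pos hw h1 h2
  have hmono := angle_strictMono (hw 0) hWpos
  set T := angle (w 0) W n with hTdef
  have hTpos : 0 < T := hmono (show 0 < n by omega)
  set l := 2 * Real.pi / T with hl
  have hlT : T * l = 2 * Real.pi := by rw [hl]; field_simp
  have hl1 : 1 < l := by rwa [hl, one_lt_div hTpos]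
  have hWle (k : ℕ) : W k ≤ W 0 := hM _ (leaf_bounds h1 h2 k).1 (leaf_bounds h1 h2 k).2
  have hfwd (i j : ℕ) (hij : i < j) :
      sepAngle (w 0) (W i) (W j) < angle (w 0) W j * l - angle (w 0) W i * l := by
    nlinarith [angle_add_sepAngle_le (hw 0) hWpos hij, sepAngle_pos (hw 0) (hWpos i) (hWpos j)]
  have hbwd (i j : ℕ) (hi : 0 < i) (hj : j ≤ n) :
      angle (w 0) W j * l - angle (w 0) W i * l < 2 * Real.pi - sepAngle (w 0) (W i) (W j) := by
    have h3 := angle_add_sepAngle_le (hw 0) hWpos hi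
    have h4 := sepAngle_mono_left (hw 0) (hWpos j) (hWpos i) (hWle j)
    have h5 : angle (w 0) W j ≤ T := hmono.monotone hj
    have h6 := sepAngle_pos (hw 0) (hWpos j) (hWpos i)
    rw [angle_zero] at h3
    rw [sepAngle_comm, ← hlT]
    nlinarith
  have hWp {v : ℕ} (hv : 1 ≤ v) (hv' : v ≤ n) : W (position n M v) = extend w v := by
    rw [hW]
    simp only [leaf_position h2 hv hv']
  -- The leaves up to `M` are met after those beyond `M`, so they are turned back by `2π`.
  have := isEmbeddedStarRep_centre hw
    (fun v => angle (w 0) W (position n M v) * l - if v ≤ M then 2 * Real.pi else 0) ?_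
  · convert this using 2 with v
    refine centre_congr fun _ => ?_
    split_ifs
    · rw [dir_sub_two_pi]
    · rw [sub_zero]
  · intro i j hi hij hj
    have hpi := position_bounds h2 hi (show i ≤ n by omega)
    have hpj := position_bounds h2 (show 1 ≤ j by omega) hj
    rw [← hWp hi (by omega), ← hWp (by omega) hj]
    by_cases hjM : j ≤ M
    · have hlt : position n M i < position n M j := by
        simp only [position, hjM, show i ≤ M by omega, if_true]; omega
      rw [if_pos hjM, if_pos (by omega)]
      have := hfwd _ _ hlt
      have := hbwd (position n M i) (position n M j) (by omega) hpj.2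
      constructor <;> linarith
    · by_cases hiM : i ≤ M
      · have hlt : position n M j < position n M i := by
          simp only [position, hjM, hiM, if_true, if_false]; omega
        rw [if_neg hjM, if_pos hiM]
        have := hfwd _ _ hlt
        have := hbwd (position n M j) (position n M i) (by omega) hpi.2
        rw [sepAngle_comm]
        constructor <;> linarith
      · have hlt : position n M i < position n M j := by
          simp only [position, hjM, hiM, if_false]; omega
        rw [if_neg hjM, if_neg hiM]
        have := hfwd _ _ hlt
        have := hbwd (position n M i) (position n M j) (by omega) hpj.2
        constructor <;> linarith

/-- A star without leaves is represented by one disk. -/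
lemma isEmbeddedStarRep_zero {w : Fin (0 + 1) → ℝ} (hw : ∀ v, 0 < w v) (Θ : ℕ → ℝ) :
    IsEmbeddedStarRep w (fun v => centre (w 0) (extend w) Θ v) w :=
  isEmbeddedStarRep_centre hw Θ fun i j _ _ _ => by omega

end StarRep

namespace StarRep

open RealRAM

/-! ### The program -/

/-- The program. Index register `2` holds a heaviest leaf, `3` the current leaf, and `4` the address
of the top of the stack. Real register `0` holds the weight of the centre, `2` the weight of the
current leaf, `3` its angle, `4` and `5` a stack entry, and in the end `8` holds the factor by
which all angles are stretched. The index registers `1`, `6`, `7` hold the constants `1`, `2`, `0`,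
and the real registers `6`, `7` the constants `1`, `0`. If `m` is the length of the input, then the
angle of the leaf `v` goes to the cell `m + v`, and the stack occupies the cells from `2 * m` on,
two for each entry. -/
def prog : Program := [
  -- The case without leaves needs nothing but the output.
  .iconst 1 1,
  .load 0 7,
  .ijumpLT 1 0 4,
  .jump 57,
  -- From `4` on: find a heaviest leaf.
  .iconst 3 1,
  .load 2 3,
  .rjumpLT 9 2 8,
  .jump 10,
  .load 9 3,
  .iadd 2 3 7,
  .iadd 3 3 1,
  .ijumpLT 3 0 5,
  -- From `12` on: push this leaf with angle `0`.
  .iconst 6 2,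
  .rconst 6 1,
  .iadd 4 0 0,
  .store 4 9,
  .iadd 5 4 1,
  .store 5 7,
  .iadd 3 2 7,
  -- From `19` on: go to the next leaf in cyclic order.
  .iadd 3 3 1,
  .ijumpLT 3 0 22,
  .iconst 3 1,
  .load 2 3,
  .rconst 3 0,
  -- From `24` on: the loop of `scan`.
  .load 4 4,
  .iadd 5 4 1,
  .load 5 5,
  .bin .add 1 0 4,
  .bin .add 8 0 2,
  .bin .mul 1 1 8,
  .bin .mul 8 4 2,
  .bin .div 1 8 1,
  .bin .add 1 1 1,
  .bin .sub 1 6 1,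
  .un .arccos 1 1,
  .bin .add 5 5 1,
  .rjumpLT 3 5 38,
  .jump 39,
  .bin .add 3 5 7,
  .rjumpLT 4 2 41,
  .jump 43,
  .isub 4 4 6,
  .jump 24,
  -- From `43` on: push the current leaf, and record its angle.
  .iadd 4 4 6,
  .store 4 2,
  .iadd 5 4 1,
  .store 5 3,
  .iadd 5 0 3,
  .store 5 3,
  .ijumpLT 3 2 19,
  .ijumpLT 2 3 19,
  -- From `51` on: back at the first leaf, compare its second angle with a full turn.
  .rconst 1 (-1),
  .un .arccos 1 1,
  .bin .add 1 1 1,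
  .rjumpLT 3 1 56,
  .halt false,
  .bin .div 8 1 3,
  -- From `57` on: write the disk of the centre, then those of the leaves.
  .write 7,
  .write 7,
  .write 0,
  .iconst 3 1,
  .ijumpLT 3 0 63,
  .halt true,
  .load 2 3,
  .iadd 5 0 3,
  .load 1 5,
  .bin .mul 1 1 8,
  .bin .add 4 0 2,
  .un .cos 5 1,
  .bin .mul 5 4 5,
  .write 5,
  .un .sin 5 1,
  .bin .mul 5 4 5,
  .bin .sub 5 7 5,
  .write 5,
  .write 2,
  .iadd 3 3 1,
  .jump 61]

/-! ### Reasoning about runs -/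

/-- From `s`, the program `P` gets within `T` steps to a configuration that satisfies `Q`. -/
def Leads (P : Program) (s : Config) (Q : Config → Prop) (T : ℕ) : Prop :=
  ∃ t s', Reaches P s s' t ∧ t ≤ T ∧ Q s'

section Leads

variable {P : Program} {s s' : Config} {Q Q' : Config → Prop} {T T' : ℕ}

lemma Leads.done (h : Q s) : Leads P s Q T := ⟨0, s, .refl s, Nat.zero_le _, h⟩

lemma Leads.step (h : step P s = some s') (H : Leads P s' Q T) : Leads P s Q (T + 1) := by
  obtain ⟨t, s'', hr, ht, hQ⟩ := H
  exact ⟨t + 1, s'', .head h hr, by omega, hQ⟩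

lemma reaches_trans {s'' : Config} {t t' : ℕ} (h : Reaches P s s' t) (h' : Reaches P s' s'' t') :
    Reaches P s s'' (t + t') := by
  induction h with
  | refl => simpa using h'
  | head h _ ih => exact (Nat.add_right_comm _ 1 t').symm ▸ .head h (ih h')

lemma Leads.trans (h : Leads P s Q T) (H : ∀ s', Q s' → Leads P s' Q' T') :
    Leads P s Q' (T + T') := by
  obtain ⟨t, s', hr, ht, hQ⟩ := h
  obtain ⟨t', s'', hr', ht', hQ'⟩ := H s' hQ
  exact ⟨t + t', s'', reaches_trans hr hr', by omega, hQ'⟩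

lemma Leads.mono (h : Leads P s Q T) (hT : T ≤ T') : Leads P s Q T' := by
  obtain ⟨t, s', hr, ht, hQ⟩ := h
  exact ⟨t, s', hr, ht.trans hT, hQ⟩

variable {pc : ℕ} {idx : ℕ → ℕ} {reg mem : ℕ → ℝ} {out : List ℝ} {a b d k l : ℕ} {q : ℚ}

lemma Leads.iconst (h : P[pc]? = some (.iconst d k))
    (H : Leads P ⟨pc + 1, Function.update idx d k, reg, mem, out⟩ Q T) :
    Leads P ⟨pc, idx, reg, mem, out⟩ Q (T + 1) :=
  .step (by simp only [RealRAM.step, h]; rfl) H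

lemma Leads.iadd (h : P[pc]? = some (.iadd d a b))
    (H : Leads P ⟨pc + 1, Function.update idx d (idx a + idx b), reg, mem, out⟩ Q T) :
    Leads P ⟨pc, idx, reg, mem, out⟩ Q (T + 1) :=
  .step (by simp only [RealRAM.step, h]; rfl) H

lemma Leads.isub (h : P[pc]? = some (.isub d a b))
    (H : Leads P ⟨pc + 1, Function.update idx d (idx a - idx b), reg, mem, out⟩ Q T) :
    Leads P ⟨pc, idx, reg, mem, out⟩ Q (T + 1) :=
  .step (by simp only [RealRAM.step, h]; rfl) H

lemma Leads.rconst (h : P[pc]? = some (.rconst d q))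
    (H : Leads P ⟨pc + 1, idx, Function.update reg d (q : ℝ), mem, out⟩ Q T) :
    Leads P ⟨pc, idx, reg, mem, out⟩ Q (T + 1) :=
  .step (by simp only [RealRAM.step, h]; rfl) H

lemma Leads.load (h : P[pc]? = some (.load d a))
    (H : Leads P ⟨pc + 1, idx, Function.update reg d (mem (idx a)), mem, out⟩ Q T) :
    Leads P ⟨pc, idx, reg, mem, out⟩ Q (T + 1) :=
  .step (by simp only [RealRAM.step, h]; rfl) H

lemma Leads.store (h : P[pc]? = some (.store a b))
    (H : Leads P ⟨pc + 1, idx, reg, Function.update mem (idx a) (reg b), out⟩ Q T) :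
    Leads P ⟨pc, idx, reg, mem, out⟩ Q (T + 1) :=
  .step (by simp only [RealRAM.step, h]; rfl) H

lemma Leads.write (h : P[pc]? = some (.write a))
    (H : Leads P ⟨pc + 1, idx, reg, mem, out ++ [reg a]⟩ Q T) :
    Leads P ⟨pc, idx, reg, mem, out⟩ Q (T + 1) :=
  .step (by simp only [RealRAM.step, h]; rfl) H

lemma Leads.jump (h : P[pc]? = some (.jump l))
    (H : Leads P ⟨l, idx, reg, mem, out⟩ Q T) :
    Leads P ⟨pc, idx, reg, mem, out⟩ Q (T + 1) :=
  .step (by simp only [RealRAM.step, h]; rfl) H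

lemma Leads.add (h : P[pc]? = some (.bin .add d a b))
    (H : Leads P ⟨pc + 1, idx, Function.update reg d (reg a + reg b), mem, out⟩ Q T) :
    Leads P ⟨pc, idx, reg, mem, out⟩ Q (T + 1) :=
  .step (by simp only [RealRAM.step, h]; rfl) H

lemma Leads.sub (h : P[pc]? = some (.bin .sub d a b))
    (H : Leads P ⟨pc + 1, idx, Function.update reg d (reg a - reg b), mem, out⟩ Q T) :
    Leads P ⟨pc, idx, reg, mem, out⟩ Q (T + 1) :=
  .step (by simp only [RealRAM.step, h]; rfl) H

lemma Leads.mul (h : P[pc]? = some (.bin .mul d a b))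
    (H : Leads P ⟨pc + 1, idx, Function.update reg d (reg a * reg b), mem, out⟩ Q T) :
    Leads P ⟨pc, idx, reg, mem, out⟩ Q (T + 1) :=
  .step (by simp only [RealRAM.step, h]; rfl) H

lemma Leads.cos (h : P[pc]? = some (.un .cos d a))
    (H : Leads P ⟨pc + 1, idx, Function.update reg d (Real.cos (reg a)), mem, out⟩ Q T) :
    Leads P ⟨pc, idx, reg, mem, out⟩ Q (T + 1) :=
  .step (by simp only [RealRAM.step, h]; rfl) H

lemma Leads.sin (h : P[pc]? = some (.un .sin d a))
    (H : Leads P ⟨pc + 1, idx, Function.update reg d (Real.sin (reg a)), mem, out⟩ Q T) :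
    Leads P ⟨pc, idx, reg, mem, out⟩ Q (T + 1) :=
  .step (by simp only [RealRAM.step, h]; rfl) H

lemma Leads.ijump_pos (h : P[pc]? = some (.ijumpLT a b l)) (hlt : idx a < idx b)
    (H : Leads P ⟨l, idx, reg, mem, out⟩ Q T) : Leads P ⟨pc, idx, reg, mem, out⟩ Q (T + 1) :=
  .step (by simp [RealRAM.step, h, Instr.exec, hlt]) H

lemma Leads.ijump_neg (h : P[pc]? = some (.ijumpLT a b l)) (hlt : ¬ idx a < idx b)
    (H : Leads P ⟨pc + 1, idx, reg, mem, out⟩ Q T) : Leads P ⟨pc, idx, reg, mem, out⟩ Q (T + 1) :=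
  .step (by simp only [RealRAM.step, h, Instr.exec, hlt, if_false, Option.bind_some]) H

lemma Leads.rjump_pos (h : P[pc]? = some (.rjumpLT a b l)) (hlt : reg a < reg b)
    (H : Leads P ⟨l, idx, reg, mem, out⟩ Q T) : Leads P ⟨pc, idx, reg, mem, out⟩ Q (T + 1) :=
  .step (by simp [RealRAM.step, h, Instr.exec, hlt]) H

lemma Leads.rjump_neg (h : P[pc]? = some (.rjumpLT a b l)) (hlt : ¬ reg a < reg b)
    (H : Leads P ⟨pc + 1, idx, reg, mem, out⟩ Q T) : Leads P ⟨pc, idx, reg, mem, out⟩ Q (T + 1) :=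
  .step (by simp only [RealRAM.step, h, Instr.exec, hlt, if_false, Option.bind_some]) H

lemma Leads.div (h : P[pc]? = some (.bin .div d a b)) (hb : reg b ≠ 0)
    (H : Leads P ⟨pc + 1, idx, Function.update reg d (reg a / reg b), mem, out⟩ Q T) :
    Leads P ⟨pc, idx, reg, mem, out⟩ Q (T + 1) :=
  .step (by simp [RealRAM.step, h, Instr.exec, BinOp.eval, hb]) H

lemma Leads.arccos (h : P[pc]? = some (.un .arccos d a)) (ha : -1 ≤ reg a ∧ reg a ≤ 1)
    (H : Leads P ⟨pc + 1, idx, Function.update reg d (Real.arccos (reg a)), mem, out⟩ Q T) :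
    Leads P ⟨pc, idx, reg, mem, out⟩ Q (T + 1) :=
  .step (by simp [RealRAM.step, h, Instr.exec, UnOp.eval, ha]) H

end Leads

variable {n M : ℕ} {w : Fin (n + 1) → ℝ}

/-- What holds throughout: the constants `0` and `1`, the input, and the empty output. -/
structure Base (w : Fin (n + 1) → ℝ) (s : Config) : Prop where
  i0 : s.idx 0 = n + 1
  i1 : s.idx 1 = 1
  i7 : s.idx 7 = 0
  r0 : s.reg 0 = w 0
  r7 : s.reg 7 = 0
  mem : ∀ a ≤ n, s.mem a = extend w a
  out : s.out = []

/-! ### Finding a heaviest leaf -/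

/-- The register `9` holds the largest weight among the leaves before `v`, attained at the leaf
in index register `2`. -/
structure FindInv (w : Fin (n + 1) → ℝ) (v : ℕ) (s : Config) : Prop extends Base w s where
  pc : s.pc = 5
  i3 : s.idx 3 = v
  ge : ∀ a, 1 ≤ a → a < v → extend w a ≤ s.reg 9
  eq : v = 1 ∧ s.reg 9 = 0 ∨ 1 ≤ s.idx 2 ∧ s.idx 2 < v ∧ s.reg 9 = extend w (s.idx 2)

/-- The leaf `M` is a heaviest leaf, and the machine has found it. -/
structure Found (w : Fin (n + 1) → ℝ) (M : ℕ) (s : Config) : Prop extends Base w s where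
  pc : s.pc = 12
  one_le : 1 ≤ M
  le : M ≤ n
  i2 : s.idx 2 = M
  r9 : s.reg 9 = extend w M
  max : ∀ a, 1 ≤ a → a ≤ n → extend w a ≤ extend w M

lemma FindInv.step (hw : ∀ v, 0 < w v) {v : ℕ} (hv : 1 ≤ v) (hvn : v ≤ n) {s : Config}
    (h : FindInv w v s) :
    Leads prog s (fun s' => v < n ∧ FindInv w (v + 1) s' ∨ v = n ∧ ∃ M, Found w M s') 6 := by
  obtain ⟨pc, idx, reg, mem, out⟩ := s
  obtain ⟨⟨i0, i1, i7, r0, r7, hmem, hout⟩, hpc, i3, ge, eq⟩ := h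
  dsimp only at *
  subst hpc
  have hwv := extend_pos hw hvn
  -- The common end of both branches.
  have tail {idx : ℕ → ℕ} {reg : ℕ → ℝ} (i0 : idx 0 = n + 1) (i1 : idx 1 = 1) (i7 : idx 7 = 0)
      (r0 : reg 0 = w 0) (r7 : reg 7 = 0) (i3 : idx 3 = v) (h2 : 1 ≤ idx 2) (h2v : idx 2 ≤ v)
      (r9 : reg 9 = extend w (idx 2)) (ge : ∀ a, 1 ≤ a → a ≤ v → extend w a ≤ reg 9) :
      Leads prog ⟨10, idx, reg, mem, out⟩
        (fun s' => v < n ∧ FindInv w (v + 1) s' ∨ v = n ∧ ∃ M, Found w M s') 2 := by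
    refine .iadd rfl ?_
    rcases hvn.lt_or_eq with hlt | rfl
    · refine .ijump_pos rfl (by simp [i0, i1, i3, hlt]) (.done (.inl ⟨hlt, ?_⟩))
      exact {
        i0 := by simp [i0], i1 := by simp [i1], i7 := by simp [i7]
        r0 := r0, r7 := r7, mem := hmem, out := hout, pc := rfl, i3 := by simp [i3, i1]
        ge := fun a ha hav => ge a ha (by omega)
        eq := .inr ⟨by simpa using h2, by simpa using by omega, by simpa using r9⟩ }
    · refine .ijump_neg rfl (by simp [i0, i1, i3]) (.done (.inr ⟨rfl, idx 2, ?_⟩))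
      exact {
        i0 := by simp [i0], i1 := by simp [i1], i7 := by simp [i7]
        r0 := r0, r7 := r7, mem := hmem, out := hout, pc := rfl, one_le := h2, le := h2v
        i2 := by simp, r9 := r9, max := r9 ▸ ge }
  refine .load rfl ?_
  by_cases hlt : reg 9 < extend w v
  · refine .rjump_pos rfl (by simpa [i3, hmem v hvn] using hlt) ?_
    refine .load rfl ?_
    refine .iadd rfl ?_
    refine tail ?_ ?_ ?_ ?_ ?_ ?_ ?_ ?_ ?_ ?_ <;> simp [*]
    intro a ha hav
    rcases hav.lt_or_eq with h | rfl
    · exact (ge a ha h).trans hlt.le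
    · exact le_rfl
  · refine .rjump_neg rfl (by simpa [i3, hmem v hvn] using hlt) ?_
    refine .jump rfl ?_
    rcases eq with ⟨rfl, h9⟩ | ⟨h2, h2v, h9⟩
    · exact absurd (h9 ▸ hwv) hlt
    · refine .mono (tail i0 i1 i7 (by simpa using r0) (by simpa using r7) i3 h2 h2v.le
        (by simpa using h9) fun a ha hav => ?_) (Nat.le_succ 2)
      rcases hav.lt_or_eq with h | rfl
      · simpa using ge a ha h
      · simpa using hlt

lemma FindInv.leads (hw : ∀ v, 0 < w v) {v : ℕ} (hv : 1 ≤ v) (hvn : v ≤ n) {s : Config}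
    (h : FindInv w v s) :
    Leads prog s (fun s' => ∃ M, Found w M s') (6 * (n + 1 - v)) := by
  induction hd : n - v generalizing v s with
  | zero =>
    refine ((h.step hw hv hvn).trans (T' := 0) fun s' hs' => .done ?_).mono (by omega)
    exact hs'.resolve_left (by omega) |>.2
  | succ d ih =>
    refine ((h.step hw hv hvn).trans (T' := 6 * (n - v)) fun s' hs' => ?_).mono (by omega)
    rcases hs' with ⟨-, hs'⟩ | ⟨hs', -⟩
    · exact (ih (by omega) (by omega) hs' (by omega)).mono (by omega)
    · omega

/-! ### The loop of `scan` -/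

/-- The memory holds the stack `L`, its bottom at the address `2 * (n + 1)`, with two cells for
each entry. The address of the top is then `2 * (n + L.length)`. -/
def StackAt (n : ℕ) (mem : ℕ → ℝ) : List (ℝ × ℝ) → Prop
  | [] => True
  | p :: L => mem (2 * (n + 1 + L.length)) = p.1 ∧ mem (2 * (n + 1 + L.length) + 1) = p.2 ∧
      StackAt n mem L

lemma StackAt.of_suffix {mem : ℕ → ℝ} {L L' : List (ℝ × ℝ)} (h : StackAt n mem L)
    (hL : L' <:+ L) : StackAt n mem L' := by
  induction L with
  | nil => rwa [List.suffix_nil.1 hL]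
  | cons p L ih =>
    rcases List.suffix_cons_iff.1 hL with rfl | hL
    · exact h
    · exact ih h.2.2 hL

lemma StackAt.congr {mem mem' : ℕ → ℝ} {L : List (ℝ × ℝ)} (h : StackAt n mem L)
    (hmem : ∀ a, 2 * (n + 1) ≤ a → a < 2 * (n + 1 + L.length) → mem' a = mem a) :
    StackAt n mem' L := by
  induction L with
  | nil => trivial
  | cons p L ih =>
    obtain ⟨h1, h2, h3⟩ := h
    rw [List.length_cons] at hmem
    refine ⟨?_, ?_, ih h3 fun a ha ha' => hmem a ha (by omega)⟩
    · rw [hmem _ (by omega) (by omega), h1]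
    · rw [hmem _ (by omega) (by omega), h2]

/-- The loop of `scan` changes only some scratch registers. -/
structure ScanFrame (s s' : Config) : Prop where
  idx : ∀ i, i ≠ 4 → i ≠ 5 → s'.idx i = s.idx i
  reg : ∀ i, i ≠ 1 → i ≠ 3 → i ≠ 4 → i ≠ 5 → i ≠ 8 → s'.reg i = s.reg i
  mem : s'.mem = s.mem
  out : s'.out = s.out

lemma ScanFrame.trans {s s' s'' : Config} (h : ScanFrame s s') (h' : ScanFrame s' s'') :
    ScanFrame s s'' where
  idx i h4 h5 := (h'.idx i h4 h5).trans (h.idx i h4 h5)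
  reg i h1 h3 h4 h5 h8 := (h'.reg i h1 h3 h4 h5 h8).trans (h.reg i h1 h3 h4 h5 h8)
  mem := h'.mem.trans h.mem
  out := h'.out.trans h.out

/-- The machine is about to scan the stack `L` for a leaf of weight `x`, with the bound `b` so
far. -/
structure ScanInv (n : ℕ) (R x : ℝ) (L : List (ℝ × ℝ)) (b : ℝ) (s : Config) : Prop where
  pc : s.pc = 24
  i1 : s.idx 1 = 1
  i4 : s.idx 4 = 2 * (n + L.length)
  i6 : s.idx 6 = 2
  r0 : s.reg 0 = R
  r2 : s.reg 2 = x
  r3 : s.reg 3 = b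
  r6 : s.reg 6 = 1
  r7 : s.reg 7 = 0
  stack : StackAt n s.mem L

/-- One stack entry is compared with the current leaf. -/
lemma ScanInv.compare {R x : ℝ} (hR : 0 < R) (hx : 0 < x) {p : ℝ × ℝ} {L : List (ℝ × ℝ)}
    (hp : 0 < p.1) {b : ℝ} {s : Config} (h : ScanInv n R x (p :: L) b s) :
    Leads prog s (fun s' => s'.pc = 39 ∧ ScanFrame s s' ∧ s'.idx 4 = s.idx 4 ∧
      s'.reg 3 = max b (p.2 + sepAngle R p.1 x) ∧ s'.reg 4 = p.1) 14 := by
  obtain ⟨pc, idx, reg, mem, out⟩ := s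
  obtain ⟨hpc, i1, i4, i6, r0, r2, r3, r6, r7, hm1, hm2, hm⟩ := h
  dsimp only at *
  subst hpc
  have hi4 : idx 4 = 2 * (n + 1 + L.length) := by rw [i4, List.length_cons]; omega
  have hq := sepRatio_pos hR hp hx
  have hq' := sepRatio_lt_one hR hp hx
  have hden : (R + p.1) * (R + x) ≠ 0 := by positivity
  set q := p.1 * x / ((R + p.1) * (R + x)) with hqdef
  -- The part of the loop body after the quotient has been computed.
  have tail {idx' : ℕ → ℕ} {reg' : ℕ → ℝ}
      (hidx : ∀ i, i ≠ 5 → idx' i = idx i)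
      (hreg : ∀ i, i ≠ 1 → i ≠ 4 → i ≠ 5 → i ≠ 8 → reg' i = reg i)
      (h4 : reg' 4 = p.1) (h5 : reg' 5 = p.2) (h1 : reg' 1 = q) :
      Leads prog ⟨32, idx', reg', mem, out⟩ (fun s' => s'.pc = 39 ∧
        ScanFrame ⟨24, idx, reg, mem, out⟩ s' ∧ s'.idx 4 = idx 4 ∧
        s'.reg 3 = max b (p.2 + sepAngle R p.1 x) ∧ s'.reg 4 = p.1) 6 := by
    have h3' : reg' 3 = b := (hreg 3 (by simp) (by simp) (by simp) (by simp)).trans r3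
    have h6' : reg' 6 = 1 := (hreg 6 (by simp) (by simp) (by simp) (by simp)).trans r6
    have h7' : reg' 7 = 0 := (hreg 7 (by simp) (by simp) (by simp) (by simp)).trans r7
    have hα : Real.arccos (1 - (q + q)) = sepAngle R p.1 x := by rw [sepAngle, two_mul]
    refine .add rfl ?_
    refine .sub rfl ?_
    refine .arccos rfl (by simp only [Function.update_self, ne_eq, Function.update_of_ne, h1, h6',
      OfNat.ofNat_ne_one, not_false_eq_true]; constructor <;> linarith) ?_
    refine .add rfl ?_
    by_cases hlt : b < p.2 + sepAngle R p.1 x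
    · refine .rjump_pos rfl (by simpa [h1, h5, h3', h6', hα] using hlt) ?_
      refine .add rfl
        (.done ⟨rfl, ⟨fun i _ hi => hidx i hi, ?_, rfl, rfl⟩, hidx 4 (by simp), ?_, ?_⟩)
      · intro i hi1 hi3 hi4 hi5 hi8
        simp [hi1, hi3, hi5, hreg i hi1 hi4 hi5 hi8]
      · simp [h1, h5, h6', h7', hα, hlt.le]
      · simp [h4]
    · refine .rjump_neg rfl (by simpa [h1, h5, h3', h6', hα] using hlt) ?_
      refine .jump rfl
        (.done ⟨rfl, ⟨fun i _ hi => hidx i hi, ?_, rfl, rfl⟩, hidx 4 (by simp), ?_, ?_⟩)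
      · intro i hi1 hi3 hi4 hi5 hi8
        simp [hi1, hi5, hreg i hi1 hi4 hi5 hi8]
      · simp [h3', not_lt.1 hlt]
      · simp [h4]
  refine .load rfl ?_
  refine .iadd rfl ?_
  refine .load rfl ?_
  refine .add rfl ?_
  refine .add rfl ?_
  refine .mul rfl ?_
  refine .mul rfl ?_
  refine .div rfl (by simpa [hi4, hm1, r0, r2] using hden) ?_
  refine tail (fun i hi => by simp [hi]) (fun i hi1 hi4 hi5 hi8 => by simp [hi1, hi4, hi5, hi8])
    ?_ ?_ ?_
  · simp [hi4, hm1]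
  · simp [hi4, hm2, i1]
  · simp [hi4, hm1, r0, r2, hqdef]

/-- The loop runs once for each popped entry, and once for the entry at which it stops. -/
lemma ScanInv.leads {R x : ℝ} (hR : 0 < R) (hx : 0 < x) {L : List (ℝ × ℝ)}
    (hpos : ∀ p ∈ L, 0 < p.1) (hL : ∃ p ∈ L, x ≤ p.1) {b : ℝ} {s : Config}
    (h : ScanInv n R x L b s) :
    Leads prog s (fun s' => s'.pc = 43 ∧ ScanFrame s s' ∧
      s'.idx 4 = 2 * (n + (scan R x L b).1.length) ∧ s'.reg 3 = (scan R x L b).2)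
      (17 * (L.length - (scan R x L b).1.length + 1)) := by
  induction L generalizing b s with
  | nil => simp at hL
  | cons p L ih =>
    have hlen := (scan_suffix (R := R) (x := x) L (max b (p.2 + sepAngle R p.1 x))).length_le
    by_cases hpx : p.1 < x
    · simp only [scan, if_pos hpx]
      refine ((h.compare hR hx (hpos p (by simp))).trans
        (T' := 3 + 17 * (L.length - (scan R x L (max b (p.2 + sepAngle R p.1 x))).1.length + 1))
        fun s' hs' => ?_).mono (by rw [List.length_cons]; omega)
      obtain ⟨pc', idx', reg', mem', out'⟩ := s'
      obtain ⟨hpc, hf, i4, r3, r4⟩ := hs'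
      dsimp only at hpc i4 r3 r4
      subst hpc
      have r2' : reg' 2 = x :=
        (hf.reg 2 (by simp) (by simp) (by simp) (by simp) (by simp)).trans h.r2
      have i6' : idx' 6 = 2 := (hf.idx 6 (by simp) (by simp)).trans h.i6
      rw [Nat.add_comm 3]
      refine .rjump_pos rfl (by rwa [r4, r2']) ?_
      refine .isub rfl ?_
      refine .jump rfl ?_
      have hL' : ∃ p ∈ L, x ≤ p.1 := by
        obtain ⟨q, hq, hxq⟩ := hL
        rcases List.mem_cons.1 hq with rfl | hq
        · exact absurd hpx hxq.not_gt
        · exact ⟨q, hq, hxq⟩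
      have hf' : ScanFrame s ⟨24, Function.update idx' 4 (idx' 4 - idx' 6), reg', mem', out'⟩ :=
        hf.trans ⟨fun i hi _ => by simp [hi], fun _ _ _ _ _ _ => rfl, rfl, rfl⟩
      have hinv : ScanInv n R x L (max b (p.2 + sepAngle R p.1 x))
          ⟨24, Function.update idx' 4 (idx' 4 - idx' 6), reg', mem', out'⟩ := {
        pc := rfl
        i1 := (hf'.idx 1 (by simp) (by simp)).trans h.i1
        i4 := by simp only [Function.update_self, i4, i6', h.i4, List.length_cons]; omega
        i6 := (hf'.idx 6 (by simp) (by simp)).trans h.i6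
        r0 := (hf'.reg 0 (by simp) (by simp) (by simp) (by simp) (by simp)).trans h.r0
        r2 := r2'
        r3 := r3
        r6 := (hf'.reg 6 (by simp) (by simp) (by simp) (by simp) (by simp)).trans h.r6
        r7 := (hf'.reg 7 (by simp) (by simp) (by simp) (by simp) (by simp)).trans h.r7
        stack := by
          rw [hf'.mem]
          exact h.stack.2.2 }
      obtain ⟨t, s'', hr, ht, h1, h2, h3, h4⟩ :=
        ih (fun q hq => hpos q (List.mem_cons_of_mem _ hq)) hL' hinv
      exact ⟨t, s'', hr, ht, h1, hf'.trans h2, h3, h4⟩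
    · simp only [scan, if_neg hpx]
      refine ((h.compare hR hx (hpos p (by simp))).trans (T' := 2)
        fun s' hs' => ?_).mono (by omega)
      obtain ⟨pc', idx', reg', mem', out'⟩ := s'
      obtain ⟨hpc, hf, i4, r3, r4⟩ := hs'
      dsimp only at hpc i4 r3 r4
      subst hpc
      have r2' : reg' 2 = x :=
        (hf.reg 2 (by simp) (by simp) (by simp) (by simp) (by simp)).trans h.r2
      refine .rjump_neg rfl (by rwa [r4, r2']) ?_
      refine .jump rfl (.done ⟨rfl, ?_, i4.trans h.i4, r3⟩)
      exact hf.trans ⟨fun _ _ _ => rfl, fun _ _ _ _ _ _ => rfl, rfl, rfl⟩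

/-! ### The loop over the leaves -/

/-- The leaves at the positions `1, …, k` have been placed. -/
structure SweepInv (w : Fin (n + 1) → ℝ) (M k : ℕ) (s : Config) : Prop extends Base w s where
  i2 : s.idx 2 = M
  i3 : s.idx 3 = leaf n M k
  i4 : s.idx 4 = 2 * (n + (sweep (w 0) (fun k => extend w (leaf n M k)) k).length)
  i6 : s.idx 6 = 2
  r6 : s.reg 6 = 1
  stack : StackAt n s.mem (sweep (w 0) (fun k => extend w (leaf n M k)) k)
  angles : ∀ i, 1 ≤ i → i ≤ k → s.mem (n + 1 + leaf n M i) =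
    angle (w 0) (fun k => extend w (leaf n M k)) i

/-- All leaves have been placed, and real register `3` holds the second angle of the leaf `M`. -/
structure Swept (w : Fin (n + 1) → ℝ) (M : ℕ) (s : Config) : Prop extends SweepInv w M n s where
  pc : s.pc = 51
  r3 : s.reg 3 = angle (w 0) (fun k => extend w (leaf n M k)) n

lemma Found.leads {s : Config} (h : Found w M s) :
    Leads prog s (fun s' => s'.pc = 19 ∧ SweepInv w M 0 s') 7 := by
  obtain ⟨pc, idx, reg, mem, out⟩ := s
  obtain ⟨⟨i0, i1, i7, r0, r7, hmem, hout⟩, hpc, h1, h2, i2, r9, -⟩ := h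
  dsimp only at *
  subst hpc
  refine .iconst rfl ?_
  refine .rconst rfl ?_
  refine .iadd rfl ?_
  refine .store rfl ?_
  refine .iadd rfl ?_
  refine .store rfl ?_
  refine .iadd rfl (.done ⟨rfl, ?_⟩)
  exact {
    i0 := by simp [i0], i1 := by simp [i1], i7 := by simp [i7], r0 := by simp [r0]
    r7 := by simp [r7], out := hout, i2 := by simp [i2], i3 := by simp [i2, i7, leaf]
    i4 := by simp [i0, sweep]; omega
    i6 := by simp
    r6 := by simp
    mem := fun a ha => by
      simp [i0, i1]
      rw [Function.update_of_ne (by omega), Function.update_of_ne (by omega), hmem a ha]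
    stack := by
      simp [sweep, StackAt, i0, i1, r7, r9, leaf, two_mul]
    angles := fun i hi hi' => by omega }

/-- One leaf is placed. The cost is paid by the entries that leave the stack. -/
lemma SweepInv.step (hw : ∀ v, 0 < w v) (h1 : 1 ≤ M) (h2 : M ≤ n)
    (hM : ∀ a, 1 ≤ a → a ≤ n → extend w a ≤ extend w M) {k : ℕ} (hk : k < n) {s : Config}
    (hpc : s.pc = 19) (h : SweepInv w M k s) :
    Leads prog s (fun s' => k + 1 < n ∧ s'.pc = 19 ∧ SweepInv w M (k + 1) s' ∨
        k + 1 = n ∧ Swept w M s')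
      (47 + 17 * (sweep (w 0) (fun k => extend w (leaf n M k)) k).length -
        17 * (sweep (w 0) (fun k => extend w (leaf n M k)) (k + 1)).length) := by
  have hWpos := extend_leaf_pos hw h1 h2
  have hlb := leaf_bounds h1 h2 (k + 1)
  obtain ⟨pc, idx, reg, mem, out⟩ := s
  obtain ⟨⟨i0, i1, i7, r0, r7, hmem, hout⟩, i2, i3, i4, i6, r6, hstack, hang⟩ := h
  dsimp only at *
  subst hpc
  set W : ℕ → ℝ := fun k => extend w (leaf n M k) with hW
  set L := sweep (w 0) W k with hL
  set S := scan (w 0) (W (k + 1)) L 0 with hS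
  have hlen : S.1.length ≤ L.length := (scan_suffix L 0).length_le
  have hsw : sweep (w 0) W (k + 1) = (W (k + 1), angle (w 0) W (k + 1)) :: S.1 := rfl
  have hang1 : angle (w 0) W (k + 1) = S.2 := rfl
  -- Fetching the next leaf takes at most five steps.
  have hfetch : Leads prog ⟨19, idx, reg, mem, out⟩ (fun s' =>
      (∀ i, i ≠ 3 → s'.idx i = idx i) ∧ s'.idx 3 = leaf n M (k + 1) ∧
      (∀ i, i ≠ 2 → i ≠ 3 → s'.reg i = reg i) ∧ s'.mem = mem ∧ s'.out = out ∧
      ScanInv n (w 0) (W (k + 1)) L 0 s') 5 := by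
    have fetch {idx' : ℕ → ℕ} (hidx : ∀ i, i ≠ 3 → idx' i = idx i)
        (h3 : idx' 3 = leaf n M (k + 1)) : Leads prog ⟨22, idx', reg, mem, out⟩ (fun s' =>
        (∀ i, i ≠ 3 → s'.idx i = idx i) ∧ s'.idx 3 = leaf n M (k + 1) ∧
        (∀ i, i ≠ 2 → i ≠ 3 → s'.reg i = reg i) ∧ s'.mem = mem ∧ s'.out = out ∧
        ScanInv n (w 0) (W (k + 1)) L 0 s') 2 := by
      refine .load rfl ?_
      refine .rconst rfl (.done ⟨hidx, h3, fun i hi2 hi3 => by simp [hi2, hi3], rfl, rfl, ?_⟩)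
      exact {
        pc := rfl, i1 := by simp [hidx, i1], i4 := by simp [hidx, i4], i6 := by simp [hidx, i6]
        r0 := by simp [r0], r2 := by simp [h3, hmem _ hlb.2, hW], r3 := by simp
        r6 := by simp [r6], r7 := by simp [r7], stack := hstack }
    refine .iadd rfl ?_
    by_cases hlt : leaf n M k + 1 < n + 1
    · refine .ijump_pos rfl (by simpa [i0, i1, i3] using hlt) ?_
      refine (fetch (fun i hi => by simp [hi]) ?_).mono (by omega)
      simp [i1, i3, leaf, show leaf n M k < n by omega]
    · refine .ijump_neg rfl (by simpa [i0, i1, i3] using hlt) ?_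
      refine .iconst rfl (fetch (fun i hi => by simp [hi]) ?_)
      simp [leaf, show ¬ leaf n M k < n by omega]
  -- The scan stops at the latest at the leaf `M`, which is never popped.
  have hexists : ∃ p ∈ L, W (k + 1) ≤ p.1 := by
    obtain ⟨p, hp, hle, -⟩ := exists_dominating_mem_sweep (hw 0) hWpos (Nat.zero_le k)
    exact ⟨p, hp, (hM _ hlb.1 hlb.2).trans hle⟩
  refine ((hfetch.trans (T' := 17 * (L.length - S.1.length + 1) + 8) ?_)).mono (by
    rw [hsw, List.length_cons]; omega)
  rintro s' ⟨hidx, h3, hreg, hm, ho, hinv⟩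
  refine (hinv.leads (hw 0) (hWpos _) (fun p hp => pos_of_mem_sweep hWpos hp) hexists).trans ?_
  rintro ⟨pc'', idx'', reg'', mem'', out''⟩ ⟨hpc'', hf, hi4, hr3⟩
  dsimp only at hpc'' hi4 hr3
  subst hpc''
  have hidx' (i : ℕ) (hi3 : i ≠ 3) (hi4 : i ≠ 4) (hi5 : i ≠ 5) : idx'' i = idx i :=
    (hf.idx i hi4 hi5).trans (hidx i hi3)
  have h3'' : idx'' 3 = leaf n M (k + 1) := (hf.idx 3 (by simp) (by simp)).trans h3
  have hr2 : reg'' 2 = W (k + 1) :=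
    (hf.reg 2 (by simp) (by simp) (by simp) (by simp) (by simp)).trans hinv.r2
  have hr (i : ℕ) (hi : i = 0 ∨ i = 6 ∨ i = 7) : reg'' i = reg i :=
    (hf.reg i (by omega) (by omega) (by omega) (by omega) (by omega)).trans
      (hreg i (by omega) (by omega))
  obtain rfl : mem'' = mem := hf.mem.trans hm
  obtain rfl : out'' = out := hf.out.trans ho
  have i0' : idx'' 0 = n + 1 := by rw [hidx' 0 (by simp) (by simp) (by simp), i0]
  have i1' : idx'' 1 = 1 := by rw [hidx' 1 (by simp) (by simp) (by simp), i1]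
  have i2' : idx'' 2 = M := by rw [hidx' 2 (by simp) (by simp) (by simp), i2]
  have i6' : idx'' 6 = 2 := by rw [hidx' 6 (by simp) (by simp) (by simp), i6]
  have i7' : idx'' 7 = 0 := by rw [hidx' 7 (by simp) (by simp) (by simp), i7]
  refine .iadd rfl ?_
  refine .store rfl ?_
  refine .iadd rfl ?_
  refine .store rfl ?_
  refine .iadd rfl ?_
  refine .store rfl ?_
  have htop : 2 * (n + S.1.length) + 2 = 2 * (n + 1 + S.1.length) := by ring
  have hfin (pc : ℕ) : SweepInv w M (k + 1) ⟨pc,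
      Function.update (Function.update (Function.update idx'' 4 (2 * (n + 1 + S.1.length))) 5
        (2 * (n + 1 + S.1.length) + 1)) 5 (n + 1 + leaf n M (k + 1)), reg'',
      Function.update (Function.update (Function.update mem'' (2 * (n + 1 + S.1.length))
        (W (k + 1))) (2 * (n + 1 + S.1.length) + 1) S.2) (n + 1 + leaf n M (k + 1)) S.2, out''⟩ := {
    i0 := by simp [i0'], i1 := by simp [i1'], i7 := by simp [i7'], i2 := by simp [i2']
    i3 := by simp [h3''], i6 := by simp [i6']
    r0 := (hr 0 (by simp)).trans r0
    r7 := (hr 7 (by simp)).trans r7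
    r6 := (hr 6 (by simp)).trans r6
    out := hout
    i4 := by
      rw [← hW, hsw, List.length_cons]
      simp only [ne_eq, Nat.reduceEqDiff, not_false_eq_true, Function.update_of_ne,
        Function.update_self]
      omega
    mem := fun a ha => by
      dsimp only
      rw [Function.update_of_ne (by omega), Function.update_of_ne (by omega),
        Function.update_of_ne (by omega), hmem a ha]
    stack := by
      rw [← hW, hsw, hang1]
      dsimp only
      refine ⟨?_, ?_, (hstack.of_suffix (scan_suffix L 0)).congr fun a ha ha' => ?_⟩
      · rw [Function.update_of_ne (by omega), Function.update_of_ne (by omega),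
          Function.update_self]
      · rw [Function.update_of_ne (by omega), Function.update_self]
      · rw [← hS] at ha'
        rw [Function.update_of_ne (by omega), Function.update_of_ne (by omega),
          Function.update_of_ne (by omega)]
    angles := fun i hi hi' => by
      dsimp only
      rcases hi'.lt_or_eq with hi' | rfl
      · have hne : leaf n M i ≠ leaf n M (k + 1) := fun he => by
          have := position_leaf h2 hi (show i ≤ n by omega)
          rw [he, position_leaf h2 (by omega) (by omega)] at this
          omega
        have := leaf_bounds h1 h2 i
        rw [Function.update_of_ne (by omega), Function.update_of_ne (by omega),
          Function.update_of_ne (by omega)]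
        exact hang i hi (by omega)
      · rw [Function.update_self, ← hang1] }
  have e4 : idx'' 4 + idx'' 6 = 2 * (n + 1 + S.1.length) := by rw [hi4, i6', htop]
  simp only [Function.update_self, ne_eq, Nat.reduceEqDiff, not_false_eq_true,
    Function.update_of_ne, OfNat.zero_ne_ofNat, OfNat.one_ne_ofNat, e4, i0',
    i1', h3'', hr2, hr3]
  rcases Nat.lt_or_ge (k + 1) n with hkn | hkn
  · have hne := leaf_ne h2 (Nat.succ_pos k) hkn
    rcases lt_or_gt_of_ne hne with hlt | hlt
    · exact .ijump_pos rfl (by simpa [i2', h3''] using hlt) (.done (.inl ⟨hkn, rfl, hfin _⟩))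
    · refine .ijump_neg rfl (by simpa [i2', h3''] using hlt.le) ?_
      exact .ijump_pos rfl (by simpa [i2', h3''] using hlt) (.done (.inl ⟨hkn, rfl, hfin _⟩))
  · obtain rfl : k + 1 = n := by omega
    have he := leaf_self h1 h2
    refine .ijump_neg rfl (by simp [i2', h3'', he]) ?_
    refine .ijump_neg rfl (by simp [i2', h3'', he]) (.done (.inr ⟨rfl, ?_⟩))
    exact { toSweepInv := hfin _, pc := rfl, r3 := hr3 }

lemma SweepInv.leads (hw : ∀ v, 0 < w v) (h1 : 1 ≤ M) (h2 : M ≤ n)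
    (hM : ∀ a, 1 ≤ a → a ≤ n → extend w a ≤ extend w M) {k : ℕ} (hk : k < n) {s : Config}
    (hpc : s.pc = 19) (h : SweepInv w M k s) :
    Leads prog s (Swept w M)
      (47 * (n - k) + 17 * (sweep (w 0) (fun k => extend w (leaf n M k)) k).length) := by
  induction hd : n - k generalizing k s with
  | zero => omega
  | succ d ih =>
    have hlen : (sweep (w 0) (fun k => extend w (leaf n M k)) (k + 1)).length ≤
        (sweep (w 0) (fun k => extend w (leaf n M k)) k).length + 1 := by
      rw [sweep_succ, List.length_cons]
      exact Nat.succ_le_succ (scan_suffix _ _).length_le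
    refine ((h.step hw h1 h2 hM hk hpc).trans (T' := 47 * d + 17 *
      (sweep (w 0) (fun k => extend w (leaf n M k)) (k + 1)).length) fun s' hs' => ?_).mono
      (by omega)
    rcases hs' with ⟨hkn, hpc', hs'⟩ | ⟨-, hs'⟩
    · exact ih hkn hpc' hs' (by omega)
    · exact .done hs'

/-! ### The decision -/

/-- The machine is about to write the disks with the centres `centre (w 0) (extend w) Θ`; the
angles `Θ` are still to be multiplied by the factor in real register `8`. -/
structure WriteReady (w : Fin (n + 1) → ℝ) (Θ : ℕ → ℝ) (s : Config) : Prop extends Base w s where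
  pc : s.pc = 57
  angles : ∀ a, 1 ≤ a → a ≤ n → s.mem (n + 1 + a) * s.reg 8 = Θ a

lemma Swept.leads_reject {s : Config} (h : Swept w M s)
    (hT : ¬ angle (w 0) (fun k => extend w (leaf n M k)) n < 2 * Real.pi) :
    Leads prog s (fun s' => prog[s'.pc]? = some (.halt false) ∧ s'.out = []) 4 := by
  obtain ⟨pc, idx, reg, mem, out⟩ := s
  have r3 := h.r3
  have hout := h.out
  obtain rfl : pc = 51 := h.pc
  dsimp only at r3 hout
  refine .rconst rfl ?_
  refine .arccos rfl (by simp) ?_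
  refine .add rfl ?_
  refine .rjump_neg rfl ?_ (.done ⟨rfl, hout⟩)
  simpa [r3, two_mul] using hT

lemma Swept.leads_accept (hw : ∀ v, 0 < w v) (h1 : 1 ≤ M) (h2 : M ≤ n) {s : Config}
    (h : Swept w M s) (hT : angle (w 0) (fun k => extend w (leaf n M k)) n < 2 * Real.pi) :
    Leads prog s (WriteReady w (fun v => angle (w 0) (fun k => extend w (leaf n M k))
      (position n M v) * (2 * Real.pi / angle (w 0) (fun k => extend w (leaf n M k)) n))) 5 := by
  have hpos : 0 < angle (w 0) (fun k => extend w (leaf n M k)) n :=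
    angle_strictMono (hw 0) (extend_leaf_pos hw h1 h2) (show 0 < n by omega)
  obtain ⟨pc, idx, reg, mem, out⟩ := s
  obtain ⟨⟨⟨i0, i1, i7, r0, r7, hmem, hout⟩, -, -, -, -, -, -, hang⟩, hpc, r3⟩ := h
  dsimp only at *
  subst hpc
  refine .rconst rfl ?_
  refine .arccos rfl (by simp) ?_
  refine .add rfl ?_
  refine .rjump_pos rfl (by simpa [r3, two_mul] using hT) ?_
  refine .div rfl (by simpa [r3] using hpos.ne') (.done ?_)
  exact {
    i0 := i0, i1 := i1, i7 := i7, r0 := by simp [r0], r7 := by simp [r7], mem := hmem, out := hout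
    pc := rfl
    angles := fun a ha ha' => by
      have hp := position_bounds h2 ha ha'
      have := hang _ hp.1 hp.2
      rw [leaf_position h2 ha ha'] at this
      simp [r3, this, two_mul] }

/-! ### The output -/

/-- The disk `v`, written out. -/
noncomputable def entry (R : ℝ) (u Θ : ℕ → ℝ) (v : ℕ) : List ℝ :=
  [centre R u Θ v 0, centre R u Θ v 1, u v]

lemma encodeDisks_centre (Θ : ℕ → ℝ) :
    encodeDisks (fun v : Fin (n + 1) => centre (w 0) (extend w) Θ v) w =
      (List.range (n + 1)).flatMap (entry (w 0) (extend w) Θ) := by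
  rw [encodeDisks, List.flatMap, ← List.map_coe_finRange_eq_range, List.map_map, List.ofFn_eq_map]
  congr 2
  funext v
  simp [entry, extend_val]

/-- The disks before `v` have been written. -/
structure WriteInv (w : Fin (n + 1) → ℝ) (Θ : ℕ → ℝ) (v : ℕ) (s : Config) : Prop where
  pc : s.pc = 61
  i0 : s.idx 0 = n + 1
  i1 : s.idx 1 = 1
  i3 : s.idx 3 = v
  r0 : s.reg 0 = w 0
  r7 : s.reg 7 = 0
  mem : ∀ a ≤ n, s.mem a = extend w a
  angles : ∀ a, 1 ≤ a → a ≤ n → s.mem (n + 1 + a) * s.reg 8 = Θ a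
  out : s.out = (List.range v).flatMap (entry (w 0) (extend w) Θ)

lemma WriteReady.leads {Θ : ℕ → ℝ} {s : Config} (h : WriteReady w Θ s) :
    Leads prog s (WriteInv w Θ 1) 4 := by
  obtain ⟨pc, idx, reg, mem, out⟩ := s
  obtain ⟨⟨i0, i1, i7, r0, r7, hmem, hout⟩, hpc, hang⟩ := h
  dsimp only at *
  subst hpc
  refine .write rfl ?_
  refine .write rfl ?_
  refine .write rfl ?_
  refine .iconst rfl (.done ?_)
  exact {
    pc := rfl, i0 := by simp [i0], i1 := by simp [i1], i3 := by simp, r0 := r0, r7 := r7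
    mem := hmem, angles := hang
    out := by simp [hout, r0, r7, entry, centre, extend] }

lemma WriteInv.step {Θ : ℕ → ℝ} {v : ℕ} (hv : 1 ≤ v) (hvn : v ≤ n) {s : Config}
    (h : WriteInv w Θ v s) : Leads prog s (WriteInv w Θ (v + 1)) 16 := by
  obtain ⟨pc, idx, reg, mem, out⟩ := s
  obtain ⟨hpc, i0, i1, i3, r0, r7, hmem, hang, hout⟩ := h
  dsimp only at *
  subst hpc
  have hΘ := hang v hv hvn
  have hm := hmem v hvn
  refine .ijump_pos rfl (by rw [i0, i3]; omega) ?_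
  refine .load rfl ?_
  refine .iadd rfl ?_
  refine .load rfl ?_
  refine .mul rfl ?_
  refine .add rfl ?_
  refine .cos rfl ?_
  refine .mul rfl ?_
  refine .write rfl ?_
  refine .sin rfl ?_
  refine .mul rfl ?_
  refine .sub rfl ?_
  refine .write rfl ?_
  refine .write rfl ?_
  refine .iadd rfl ?_
  refine .jump rfl (.done ?_)
  exact {
    pc := rfl, i0 := by simp [i0], i1 := by simp [i1], i3 := by simp [i3, i1]
    r0 := by simp [r0], r7 := by simp [r7]
    mem := hmem, angles := fun a ha ha' => by simpa using hang a ha ha'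
    out := by
      simp [hout, r0, r7, i0, i3, hm, hΘ, List.range_succ, entry, centre, dir,
        show v ≠ 0 by omega] }

lemma WriteInv.leads {Θ : ℕ → ℝ} {v : ℕ} (hv : 1 ≤ v) (hvn : v ≤ n + 1) {s : Config}
    (h : WriteInv w Θ v s) :
    Leads prog s (fun s' => prog[s'.pc]? = some (.halt true) ∧
      s'.out = encodeDisks (fun v : Fin (n + 1) => centre (w 0) (extend w) Θ v) w)
      (16 * (n + 1 - v) + 1) := by
  induction hd : n + 1 - v generalizing v s with
  | zero =>
    obtain rfl : v = n + 1 := by omega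
    obtain ⟨pc, idx, reg, mem, out⟩ := s
    obtain rfl : pc = 61 := h.pc
    have i0 : idx 0 = n + 1 := h.i0
    have i3 : idx 3 = n + 1 := h.i3
    refine .ijump_neg rfl (by rw [i0, i3]; omega) (.done ⟨rfl, ?_⟩)
    rw [encodeDisks_centre]
    exact h.out
  | succ d ih =>
    exact ((h.step hv (by omega)).trans fun s' hs' =>
      ih (by omega) (by omega) hs' (by omega)).mono (by omega)

/-! ### The whole run -/

lemma leads_of_pos (w : Fin (n + 1) → ℝ) (hn : 0 < n) :
    Leads prog (init w) (FindInv w 1) 4 := by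
  refine .iconst rfl ?_
  refine .load rfl ?_
  refine .ijump_pos rfl (by simpa [init] using hn) ?_
  refine .iconst rfl (.done ?_)
  exact {
    i0 := rfl, i1 := by simp, i7 := rfl, r0 := rfl
    r7 := rfl, mem := fun a _ => rfl, out := rfl, pc := rfl, i3 := by simp
    ge := fun a ha ha' => by omega
    eq := .inl ⟨rfl, rfl⟩ }

lemma leads_of_zero (w : Fin (0 + 1) → ℝ) (Θ : ℕ → ℝ) :
    Leads prog (init w) (WriteReady w Θ) 4 := by
  refine .iconst rfl ?_
  refine .load rfl ?_
  refine .ijump_neg rfl (by decide) ?_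
  refine .jump rfl (.done ?_)
  exact {
    i0 := rfl, i1 := by simp, i7 := rfl, r0 := rfl
    r7 := rfl, mem := fun a _ => rfl, out := rfl, pc := rfl
    angles := fun a ha ha' => by omega }

lemma Leads.haltsWithin {P : Program} {m : ℕ} {x : Fin m → ℝ} {b : Bool} {out : List ℝ} {T T' : ℕ}
    (h : Leads P (init x) (fun s => P[s.pc]? = some (.halt b) ∧ s.out = out) T) (hT : T < T') :
    HaltsWithin P x T' b out := by
  obtain ⟨t, s, hr, ht, h1, h2⟩ := h
  exact ⟨t, s, hr, by omega, h1, h2⟩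

end StarRep

open StarRep in
theorem mainTheorem6 :
    ∃ (P : RealRAM.Program) (C : ℕ), ∀ (n : ℕ) (w : Fin (n + 1) → ℝ), (∀ v, 0 < w v) →
      ∃ (b : Bool) (out : List ℝ),
        RealRAM.HaltsWithin P w (C * (n + 1)) b out ∧
        (b = true ↔ ∃ p r, IsEmbeddedStarRep w p r) ∧
        (b = true → ∃ p r, IsEmbeddedStarRep w p r ∧ out = encodeDisks p r) := by
  -- For `n ≥ 1` the phases take `4`, `6 * n`, `7`, `47 * n + 17`, `5`, `4` and `16 * n + 1` steps,
  -- and the final `halt` counts as one more.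
  refine ⟨prog, 80, fun n w hw => ?_⟩
  rcases Nat.eq_zero_or_pos n with rfl | hn
  · have hrun := ((leads_of_zero w 0).trans fun _ h => h.leads).trans
      fun _ h => h.leads le_rfl (by omega)
    have hrep := isEmbeddedStarRep_zero hw 0
    exact ⟨true, _, hrun.haltsWithin (by norm_num), ⟨fun _ => ⟨_, _, hrep⟩, fun _ => rfl⟩,
      fun _ => ⟨_, _, hrep, rfl⟩⟩
  · obtain ⟨t, s, hr, ht, M, hs⟩ :=
      (leads_of_pos w hn).trans fun _ h => h.leads hw le_rfl hn
    have hM := hs.one_le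
    have hMn := hs.le
    have hswept := (Leads.trans (Q := Found w M) ⟨t, s, hr, ht, hs⟩ fun _ h => h.leads).trans
      fun _ h => h.2.leads hw hM hMn hs.max hn h.1
    have hlen : (sweep (w 0) (fun k => extend w (leaf n M k)) 0).length = 1 := rfl
    by_cases hT : angle (w 0) (fun k => extend w (leaf n M k)) n < 2 * Real.pi
    · have hrun := ((hswept.trans fun _ h => h.leads_accept hw hM hMn hT).trans
        fun _ h => h.leads).trans fun _ h => h.leads le_rfl (by omega)
      have hrep := isEmbeddedStarRep_stretched hw hM hMn hs.max hT
      exact ⟨true, _, hrun.haltsWithin (by omega), ⟨fun _ => ⟨_, _, hrep⟩, fun _ => rfl⟩,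
        fun _ => ⟨_, _, hrep, rfl⟩⟩
    · have hrun := hswept.trans fun _ h => h.leads_reject hT
      refine ⟨false, _, hrun.haltsWithin (by omega), ⟨by simp, ?_⟩, by simp⟩
      rintro ⟨p, r, h⟩
      exact absurd (angle_lt_two_pi_of_isEmbeddedStarRep hw hM hMn h) hT
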